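/- Let $\bar A\in\{0,1\}^{n\times n}$ and $\bar B\in\{0,1\}^{n\times q}$, $n\ge 1$, be structured matrices: an entry $0$ is a fixed zero and an entry $1$ is a free real parameter. The pair $(\bar A,\bar B)$ is structurally controllable if some choice of the free parameters yields real matrices $(A,B)$ for which the system $x(t+1)=Ax(t)+Bu(t)$ is controllable. Let $\mathcal X=\{x_1,\dots,x_n\}$ and $\mathcal U=\{u_1,\dots,u_q\}$ be the state and input vertices, let $\mathcal D(\bar A)$ be the digraph on $\mathcal X$ with an edge $(x_i,x_j)$ whenever $\bar A_{ji}\ne 0$, and let $\mathcal E_{\mathcal U,\mathcal X}=\{(u_j,x_i):\bar B_{ij}\neq 0\}$ be the set of input links. Every input $u_j$ has a cost $c(j)\ge 0$. Let $S=\{1,\dots,q\}$; for $J\subseteq S$ let $\bar B_J$ be the submatrix of the columns of $\bar B$ indexed by $J$. The minimal cost actuator deletion problem is $$\min_{J_c\subseteq S}\ \sum_{i\in J_c}c(i)\quad\text{subject to}\quad (\bar A,\bar B_{S\setminus J_c})\ \text{is not structurally controllable}.$$ A source SCC of $\mathcal D(\bar A)$ is a strongly connected component without incoming edges from other strongly connected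 components. Let $\mathcal N_1,\dots,\mathcal N_l$ be the source SCCs of $\mathcal D(\bar A)$, and let $c^u_i$ be the sum of the costs $c(j)$ of the inputs $u_j$ that have an input link $(u_j,x)$ to some vertex $x$ of $\mathcal N_i$. Suppose that every state vertex has a self-loop, i.e. $\bar A_{ii}\ne 0$ for all $i$. Then the optimal value of the minimal cost actuator deletion problem is attained and equals $\min_{1\le i\le l}c^u_i$. Moreover, there is one algorithm that, for every such $(\bar A,\bar B,c)$, computes the optimal value and an optimal set $J_c$ in time $O(|\mathcal X|^2+|\mathcal E_{\mathcal U,\mathcal X}|)$; in particular, in time $O(|\mathcal X|^2)$ when $q\le n$. Here time is the number of steps of a random access machine whose elementary operations are copying, array access, counting up or down by one and comparison for natural numbers, and copying, array access, addition and comparison for real numbers; $\bar A$ is given as a matrix and the input links as a list, for every state, of the inputs linked to it. -/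

import Mathlib

open Matrix

namespace ActuatorDeletion

/-! ### Digraphs, strongly connected components -/

section Graph

variable {V : Type*}

/-- The subgraph of `G` induced on `N` is strongly connected (and nonempty): any two vertices of
`N` are joined by a directed path that stays inside `N`. -/
def IsStronglyConnectedOn (G : Digraph V) (N : Set V) : Prop :=
  N.Nonempty ∧
    ∀ v ∈ N, ∀ w ∈ N, Relation.ReflTransGen (fun a b => a ∈ N ∧ b ∈ N ∧ G.Adj a b) v w

/-- `N` is the vertex set of a strongly connected component: a maximal strongly connected part. -/
def IsSCC (G : Digraph V) (N : Set V) : Prop :=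
  Maximal (IsStronglyConnectedOn G) N

/-- A source SCC: an SCC with no incoming edge from a vertex of another SCC. -/
def IsSourceSCC (G : Digraph V) (N : Set V) : Prop :=
  IsSCC G N ∧
    ∀ N', IsSCC G N' → N' ≠ N → ∀ v ∈ N', ∀ w ∈ N, ¬ G.Adj v w

/-- The in-neighbours of a vertex set `N`: the vertices outside `N` with an edge into `N`. -/
def inNeighbors (G : Digraph V) (N : Set V) : Set V :=
  {v | v ∉ N ∧ ∃ w ∈ N, G.Adj v w}

end Graph

/-! ### Structured systems `x(t+1) = A x(t) + B u(t)` and structural controllability -/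

section Control

variable {ι κ : Type*} [Fintype ι] [Fintype κ]

/-- The solution of `x(t+1) = A x(t) + B u(t)`, `x(0) = x₀`. -/
def trajectory (A : Matrix ι ι ℝ) (B : Matrix ι κ ℝ) (x₀ : ι → ℝ) (u : ℕ → κ → ℝ) : ℕ → ι → ℝ
  | 0 => x₀
  | t + 1 => A *ᵥ trajectory A B x₀ u t + B *ᵥ u t

/-- `(A, B)` is controllable: every state can be steered to every state in finitely many steps. -/
def Controllable (A : Matrix ι ι ℝ) (B : Matrix ι κ ℝ) : Prop :=
  ∀ x₀ x₁ : ι → ℝ, ∃ (u : ℕ → κ → ℝ) (T : ℕ), trajectory A B x₀ u T = x₁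

/-- `M` has the sparsity pattern of the structured matrix `S`: an entry `true` of `S` is a free real
parameter, an entry `false` a fixed zero. -/
def IsRealization {α β : Type*} (S : Matrix α β Bool) (M : Matrix α β ℝ) : Prop :=
  ∀ i j, S i j = false → M i j = 0

/-- `(A, B)` is structurally controllable: some realization is controllable. -/
def StructurallyControllable (A : Matrix ι ι Bool) (B : Matrix ι κ Bool) : Prop :=
  ∃ (A' : Matrix ι ι ℝ) (B' : Matrix ι κ ℝ),
    IsRealization A A' ∧ IsRealization B B' ∧ Controllable A' B'

/-- `D(A)`: the digraph on the states, with an edge `x_i → x_j` iff `A_{ji} ≠ 0`. -/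
def stateDigraph (A : Matrix ι ι Bool) : Digraph ι where
  Adj i j := A j i = true

/-- `D(A, B)`: the digraph on states (`inl`) and inputs (`inr`), with the edges of `D(A)` and an
edge `u_j → x_i` iff `B_{ij} ≠ 0`. -/
def systemDigraph (A : Matrix ι ι Bool) (B : Matrix ι κ Bool) : Digraph (ι ⊕ κ) where
  Adj
    | .inl i, .inl j => A j i = true
    | .inr j, .inl i => B i j = true
    | _, .inr _ => False

/-- The submatrix of `B` that remains when the columns (inputs) in `J` are deleted. -/
def deleteInputs [DecidableEq κ] (B : Matrix ι κ Bool) (J : Finset κ) : Matrix ι {j : κ // j ∉ J} Bool :=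
  B.submatrix id Subtype.val

/-- The input removal sets: deleting the inputs in `J` makes the system structurally
uncontrollable. -/
def IsInputRemovalSet [DecidableEq κ] (A : Matrix ι ι Bool) (B : Matrix ι κ Bool) (J : Finset κ) : Prop :=
  ¬ StructurallyControllable A (deleteInputs B J)

/-- The objective values of the feasible points of the minimal cost actuator deletion problem. -/
def feasibleCosts [DecidableEq κ] (A : Matrix ι ι Bool) (B : Matrix ι κ Bool) (c : κ → ℝ) : Set ℝ :=
  {r | ∃ J : Finset κ, IsInputRemovalSet A B J ∧ r = ∑ j ∈ J, c j}

open Classical in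
/-- The total cost of the inputs adjacent, in `D(A, B)`, to the set `N` of states. -/
noncomputable def adjacentInputCost (A : Matrix ι ι Bool) (B : Matrix ι κ Bool) (c : κ → ℝ)
    (N : Set ι) : ℝ :=
  ∑ j : κ with Sum.inr j ∈ inNeighbors (systemDigraph A B) (Sum.inl '' N), c j

/-- The values `adjacentInputCost N`, for `N` ranging over the source SCCs of `D(A)`. -/
def sourceCosts (A : Matrix ι ι Bool) (B : Matrix ι κ Bool) (c : κ → ℝ) : Set ℝ :=
  {r | ∃ N : Set ι, IsSourceSCC (stateDigraph A) N ∧ r = adjacentInputCost A B c N}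

/-- The number of input links `(u_j, x_i)`, that is, of nonzero entries of `B`. -/
def inputLinkCount (B : Matrix ι κ Bool) : ℕ :=
  (Finset.univ.filter fun p : ι × κ => B p.1 p.2 = true).card

end Control

/-! ### A random access machine

Registers and two-dimensional arrays hold natural numbers; separate registers and one-dimensional
arrays hold real numbers. On natural numbers the machine can only copy, count up and down by one,
address arrays, and compare; on real numbers it can only copy, add and compare. Every such
instruction and every test takes one step. -/

/-- The memory. `nreg`, `narr` hold natural numbers, `rreg`, `rarr` real numbers. Registers and
arrays have numbers, so `narr a i j` is entry `(i, j)` of array number `a`. -/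
structure Store where
  nreg : ℕ → ℕ
  narr : ℕ → ℕ → ℕ → ℕ
  rreg : ℕ → ℝ
  rarr : ℕ → ℕ → ℝ

namespace Store

/-- Overwrite natural register `r`. -/
def setN (s : Store) (r v : ℕ) : Store :=
  { s with nreg := fun r' => if r' = r then v else s.nreg r' }

/-- Overwrite entry `(i, j)` of array `a` of natural numbers. -/
def setNArr (s : Store) (a i j v : ℕ) : Store :=
  { s with narr := fun a' i' j' => if a' = a ∧ i' = i ∧ j' = j then v else s.narr a' i' j' }

/-- Overwrite real register `x`. -/
noncomputable def setR (s : Store) (x : ℕ) (v : ℝ) : Store :=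
  { s with rreg := fun x' => if x' = x then v else s.rreg x' }

/-- Overwrite entry `i` of array `a` of real numbers. -/
noncomputable def setRArr (s : Store) (a i : ℕ) (v : ℝ) : Store :=
  { s with rarr := fun a' i' => if a' = a ∧ i' = i then v else s.rarr a' i' }

end Store

/-- Elementary instructions; the arguments are register numbers and array numbers, except for the
literal `k` of `const`. -/
inductive Instr where
  | const (r k : ℕ)
  | copy (r s : ℕ)
  | succ (r : ℕ)
  | pred (r : ℕ)
  | load (r a i j : ℕ)
  | store (a i j r : ℕ)
  | rcopy (x y : ℕ)
  | rplus (x y : ℕ)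
  | rload (x a i : ℕ)
  | rstore (a i x : ℕ)

/-- The effect of an elementary instruction. -/
noncomputable def Instr.exec : Instr → Store → Store
  | .const r k, s => s.setN r k
  | .copy r r', s => s.setN r (s.nreg r')
  | .succ r, s => s.setN r (s.nreg r + 1)
  | .pred r, s => s.setN r (s.nreg r - 1)
  | .load r a i j, s => s.setN r (s.narr a (s.nreg i) (s.nreg j))
  | .store a i j r, s => s.setNArr a (s.nreg i) (s.nreg j) (s.nreg r)
  | .rcopy x y, s => s.setR x (s.rreg y)
  | .rplus x y, s => s.setR x (s.rreg x + s.rreg y)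
  | .rload x a i, s => s.setR x (s.rarr a (s.nreg i))
  | .rstore a i x, s => s.setRArr a (s.nreg i) (s.rreg x)

/-- Programs. `ifLe r r'` and `whileLt r r'` test natural registers, `ifRLe x y` tests real
registers. -/
inductive Prog where
  | skip
  | instr (I : Instr)
  | seq (P Q : Prog)
  | ifLe (r r' : ℕ) (P Q : Prog)
  | ifRLe (x y : ℕ) (P Q : Prog)
  | whileLt (r r' : ℕ) (P : Prog)

/-- `Runs P s t s'`: started on memory `s`, the program `P` halts after exactly `t` steps with
memory `s'`. -/
inductive Runs : Prog → Store → ℕ → Store → Prop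
  | skip (s : Store) : Runs .skip s 0 s
  | instr (I : Instr) (s : Store) : Runs (.instr I) s 1 (I.exec s)
  | seq {P Q : Prog} {s₁ s₂ s₃ : Store} {t₁ t₂ : ℕ} :
      Runs P s₁ t₁ s₂ → Runs Q s₂ t₂ s₃ → Runs (.seq P Q) s₁ (t₁ + t₂) s₃
  | ifLeTrue {r r' : ℕ} {P Q : Prog} {s s' : Store} {t : ℕ} :
      s.nreg r ≤ s.nreg r' → Runs P s t s' → Runs (.ifLe r r' P Q) s (t + 1) s'
  | ifLeFalse {r r' : ℕ} {P Q : Prog} {s s' : Store} {t : ℕ} :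
      ¬ s.nreg r ≤ s.nreg r' → Runs Q s t s' → Runs (.ifLe r r' P Q) s (t + 1) s'
  | ifRLeTrue {x y : ℕ} {P Q : Prog} {s s' : Store} {t : ℕ} :
      s.rreg x ≤ s.rreg y → Runs P s t s' → Runs (.ifRLe x y P Q) s (t + 1) s'
  | ifRLeFalse {x y : ℕ} {P Q : Prog} {s s' : Store} {t : ℕ} :
      ¬ s.rreg x ≤ s.rreg y → Runs Q s t s' → Runs (.ifRLe x y P Q) s (t + 1) s'
  | whileDone {r r' : ℕ} {P : Prog} {s : Store} :
      ¬ s.nreg r < s.nreg r' → Runs (.whileLt r r' P) s 1 s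
  | whileStep {r r' : ℕ} {P : Prog} {s₁ s₂ s₃ : Store} {t₁ t₂ : ℕ} :
      s₁.nreg r < s₁.nreg r' → Runs P s₁ t₁ s₂ → Runs (.whileLt r r' P) s₂ t₂ s₃ →
      Runs (.whileLt r r' P) s₁ (t₁ + t₂ + 1) s₃

/-- The list, in increasing order, of the inputs that actuate the state `x_i`. -/
def inputsOf {n q : ℕ} (B : Matrix (Fin n) (Fin q) Bool) (i : Fin n) : List (Fin q) :=
  (List.finRange q).filter fun j => B i j

/-- The memory at the start (vertices are numbered from `0`):
* natural registers `0` and `1` hold the numbers `n` of states and `q` of inputs;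
* array `0` of natural numbers holds the 0-1 matrix `A`;
* the input links are given by lists: entry `(i, 0)` of array `1` is the number of inputs that
  actuate `x_i`, and row `i` of array `2` lists these inputs;
* array `0` of real numbers holds the costs of the inputs.

Everything else is `0`. -/
noncomputable def inputStore {n q : ℕ} (A : Matrix (Fin n) (Fin n) Bool)
    (B : Matrix (Fin n) (Fin q) Bool) (c : Fin q → ℝ) : Store where
  nreg r := if r = 0 then n else if r = 1 then q else 0
  narr a i j :=
    if hi : i < n then
      if a = 0 then
        if hj : j < n then (A ⟨i, hi⟩ ⟨j, hj⟩).toNat else 0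
      else if a = 1 then
        if j = 0 then (inputsOf B ⟨i, hi⟩).length else 0
      else if a = 2 then
        ((inputsOf B ⟨i, hi⟩)[j]?.map Fin.val).getD 0
      else 0
    else 0
  rreg _ := 0
  rarr a j := if a = 0 then if hj : j < q then c ⟨j, hj⟩ else 0 else 0

/-- The set of inputs returned by the machine: those `j` for which entry `(j, 0)` of array `3` is
`1`. -/
def outputSet (q : ℕ) (s : Store) : Finset (Fin q) :=
  Finset.univ.filter fun j => s.narr 3 j 0 = 1

/-- The real number returned by the machine, in real register `0`. -/
def outputValue (s : Store) : ℝ := s.rreg 0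

end ActuatorDeletion

/-! Because of the self-loops, controllability depends only on reachability: the system is
structurally controllable iff every source SCC has an input link (`structurallyControllable_iff`).
The states of a source SCC are driven only by each other, so without a link they stay at zero when
started from zero. Conversely, if every source SCC is linked, every vertex is reachable from a
linked one, and the vertices can be ranked injectively so that each unlinked vertex has a
predecessor of lower rank. The free diagonal then allows a realization that is triangular in the
rank order, with the distinct ranks as eigenvalues and 0-1 entries off the diagonal. A left
eigenvector, scaled to be nonnegative at its top coordinate, is nonnegative everywhere; if it
annihilates the input matrix, it vanishes (`eq_zero_of_eigenvector`). So a set of inputs is a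
removal set iff it contains all inputs linked to some source SCC, and as costs are nonnegative the
cheapest such SCC gives the optimum.

The algorithm tries the vertices as candidates in order and skips those that descend from an earlier
candidate. From a new candidate `v`, a forward search extends the set of marked descendants, and a
backward search collects ancestors of `v` among the marked vertices. No vertex marked before `v`
reaches `v`, so the vertices collected are also descendants of `v`; if no unmarked predecessor is
met, they form a source SCC (`backwardSearch_isSourceSCC`). No source SCC is missed: a skipped
vertex in one has an earlier candidate as ancestor, which lies in the same SCC. Marks are never
erased, so each search expands a vertex at most once over the whole run, at cost linear in `n` plus
its number of links. The potentials in `candidateStep_ok` make this amortization precise. -/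

namespace ActuatorDeletion

/-! ### Source strongly connected components -/

section Graph

variable {V : Type*} {G : Digraph V}

/-- `Reach G v w`: there is a directed path from `v` to `w`. -/
abbrev Reach (G : Digraph V) : V → V → Prop := Relation.ReflTransGen G.Adj

/-- Followed backwards from its end, a path cannot leave a predecessor-closed set. -/
theorem reach_within_of_closed {N : Set V} (hN : ∀ w ∈ N, ∀ v, G.Adj v w → v ∈ N) {v w : V}
    (h : Reach G v w) (hw : w ∈ N) :
    v ∈ N ∧ Relation.ReflTransGen (fun a b => a ∈ N ∧ b ∈ N ∧ G.Adj a b) v w := by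
  induction h using Relation.ReflTransGen.head_induction_on with
  | refl => exact ⟨hw, .refl⟩
  | head hab _ ih => exact ⟨hN _ ih.1 _ hab, .head ⟨hN _ ih.1 _ hab, ih.1, hab⟩ ih.2⟩

theorem IsStronglyConnectedOn.reach {N : Set V} (h : IsStronglyConnectedOn G N) {v w : V}
    (hv : v ∈ N) (hw : w ∈ N) : Reach G v w :=
  Relation.ReflTransGen.mono (p := G.Adj) (fun _ _ h => h.2.2) _ _ (h.2 v hv w hw)

theorem isSCC_component (v : V) : IsSCC G {w | Reach G v w ∧ Reach G w v} := by
  refine ⟨⟨⟨v, .refl, .refl⟩, ?_⟩, ?_⟩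
  · rintro a ⟨ha, ha'⟩ b ⟨hb, hb'⟩
    have hab : Reach G a b := Relation.ReflTransGen.trans ha' hb
    clear hb ha'
    induction hab using Relation.ReflTransGen.head_induction_on with
    | refl => exact .refl
    | head hac hcb ih =>
      have hc := ha.tail hac
      exact .head ⟨⟨ha, .head hac (hcb.trans hb')⟩, ⟨hc, hcb.trans hb'⟩, hac⟩ (ih hc)
  · intro M hM hsub m hm
    have hv : v ∈ M := hsub ⟨.refl, .refl⟩
    exact ⟨hM.reach hv hm, hM.reach hm hv⟩

/-- Maximality is automatic for a predecessor-closed set, since anything that reaches it lies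
inside. Conversely, a predecessor outside `N` would belong to its own SCC, which differs from `N`.
-/
theorem isSourceSCC_iff {N : Set V} : IsSourceSCC G N ↔
    IsStronglyConnectedOn G N ∧ ∀ w ∈ N, ∀ v, G.Adj v w → v ∈ N := by
  constructor
  · rintro ⟨hN, hsrc⟩
    refine ⟨hN.1, fun w hw v hvw => ?_⟩
    by_contra hv
    have hself : v ∈ {w | Reach G v w ∧ Reach G w v} := ⟨.refl, .refl⟩
    exact hsrc _ (isSCC_component v) (fun h => hv (h ▸ hself)) v hself w hw hvw
  · rintro ⟨hN, hcl⟩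
    refine ⟨⟨hN, fun M hM hsub m hm => ?_⟩, fun N' hN' hne v hv w hw hvw => hne ?_⟩
    · obtain ⟨w, hw⟩ := hN.1
      exact (reach_within_of_closed hcl (hM.reach hm (hsub hw)) hw).1
    · have hvN := hcl w hw v hvw
      have hsub : N' ⊆ N := fun a ha =>
        (reach_within_of_closed hcl (hN'.1.reach ha hv) hvN).1
      exact (hsub.antisymm (hN'.2 hN hsub))

theorem isSourceSCC_ancestors {v : V} (hv : ∀ w, Reach G w v → Reach G v w) :
    IsSourceSCC G {w | Reach G w v} := by
  have hcl : ∀ w ∈ {w | Reach G w v}, ∀ u, G.Adj u w → u ∈ {w | Reach G w v} :=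
    fun w hw u huw => .head huw hw
  refine isSourceSCC_iff.2 ⟨⟨⟨v, .refl⟩, fun a ha b hb => ?_⟩, hcl⟩
  exact (reach_within_of_closed hcl (Relation.ReflTransGen.trans ha (hv b hb)) hb).2

theorem IsSourceSCC.eq_ancestors {N : Set V} (hN : IsSourceSCC G N) {v : V} (hv : v ∈ N) :
    N = {w | Reach G w v} := by
  obtain ⟨hs, hcl⟩ := isSourceSCC_iff.1 hN
  exact Set.ext fun w => ⟨fun hw => hs.reach hw hv, fun hw => (reach_within_of_closed hcl hw hv).1⟩

theorem IsSourceSCC.reach {N : Set V} (hN : IsSourceSCC G N) {v w : V} (hv : v ∈ N)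
    (hw : w ∈ N) : Reach G v w :=
  (isSourceSCC_iff.1 hN).1.reach hv hw

/-- A vertex of `U` with fewest ancestors works: each of its ancestors has the same ancestor set,
hence is reached from it. -/
theorem exists_isSourceSCC_subset [Finite V] {U : Set V} (hne : U.Nonempty)
    (hU : ∀ w ∈ U, ∀ v, G.Adj v w → v ∈ U) : ∃ N ⊆ U, IsSourceSCC G N := by
  obtain ⟨v, hv, hmin⟩ := Set.exists_min_image U (fun v => {w | Reach G w v}.ncard)
    (Set.toFinite U) hne
  refine ⟨{w | Reach G w v}, fun w hw => (reach_within_of_closed hU hw hv).1,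
    isSourceSCC_ancestors fun w hw => ?_⟩
  have hsub : {u | Reach G u w} ⊆ {u | Reach G u v} := fun u hu => Relation.ReflTransGen.trans hu hw
  have heq := Set.eq_of_subset_of_ncard_le hsub
    (hmin w (reach_within_of_closed hU hw hv).1) (Set.toFinite _)
  have : v ∈ {u | Reach G u v} := Relation.ReflTransGen.refl
  rw [← heq] at this
  exact this

end Graph

/-! ### Controllability -/

section Control

variable {ι κ : Type*} [Fintype ι]

/-- The states that can be reached from `0` in `T` steps. -/
def reachableSubspace [Fintype κ] (A : Matrix ι ι ℝ) (B : Matrix ι κ ℝ) : ℕ → Submodule ℝ (ι → ℝ)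
  | 0 => ⊥
  | T + 1 => (reachableSubspace A B T).map A.mulVecLin ⊔ LinearMap.range B.mulVecLin

theorem reachableSubspace_mono [Fintype κ] (A : Matrix ι ι ℝ) (B : Matrix ι κ ℝ) :
    Monotone (reachableSubspace A B) := by
  refine monotone_nat_of_le_succ fun T => ?_
  induction T with
  | zero => exact bot_le
  | succ T ih => exact sup_le_sup (Submodule.map_mono ih) le_rfl

theorem pow_mulVec_mem_reachableSubspace [Fintype κ] [DecidableEq ι] (A : Matrix ι ι ℝ) (B : Matrix ι κ ℝ) (k : ℕ)
    (w : κ → ℝ) : (A ^ k * B) *ᵥ w ∈ reachableSubspace A B (k + 1) := by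
  induction k with
  | zero => exact Submodule.mem_sup_right ⟨w, by simp⟩
  | succ k ih =>
    exact Submodule.mem_sup_left ⟨_, ih, by simp [pow_succ', Matrix.mul_assoc]⟩

theorem trajectory_congr [Fintype κ] (A : Matrix ι ι ℝ) (B : Matrix ι κ ℝ) (x : ι → ℝ) {u u' : ℕ → κ → ℝ}
    {T : ℕ} (h : ∀ t < T, u t = u' t) : trajectory A B x u T = trajectory A B x u' T := by
  induction T with
  | zero => rfl
  | succ T ih =>
    simp only [trajectory]
    rw [ih fun t ht => h t (by omega), h T (by omega)]

theorem exists_trajectory_eq [Fintype κ] [DecidableEq ι] (A : Matrix ι ι ℝ) (B : Matrix ι κ ℝ) (x : ι → ℝ) {T : ℕ} {y : ι → ℝ}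
    (hy : y ∈ reachableSubspace A B T) : ∃ u, trajectory A B x u T = (A ^ T) *ᵥ x + y := by
  induction T generalizing y with
  | zero =>
    obtain rfl : y = 0 := by simpa [reachableSubspace] using hy
    exact ⟨0, by simp [trajectory]⟩
  | succ T ih =>
    obtain ⟨_, ⟨z, hz, rfl⟩, _, ⟨w, rfl⟩, rfl⟩ := Submodule.mem_sup.1 hy
    obtain ⟨u, hu⟩ := ih hz
    refine ⟨Function.update u T w, ?_⟩
    simp only [trajectory, Function.update_self]
    rw [trajectory_congr A B x (u' := u) fun t ht => Function.update_of_ne ht.ne _ _, hu]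
    simp [Matrix.mulVec_add, pow_succ', add_assoc]

/-- The increasing chain of reachable subspaces stabilizes. If its limit were proper, a nonzero
functional would vanish on it and so on the image of every `A ^ k * B`. -/
theorem controllable_of_forall_vecMul [Fintype κ] [DecidableEq ι] (A : Matrix ι ι ℝ) (B : Matrix ι κ ℝ)
    (h : ∀ f : ι → ℝ, (∀ k, f ᵥ* (A ^ k * B) = 0) → f = 0) : Controllable A B := by
  obtain ⟨T, hT⟩ := monotone_stabilizes_iff_noetherian.2
    (inferInstance : IsNoetherian ℝ (ι → ℝ)) ⟨_, reachableSubspace_mono A B⟩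
  have htop : reachableSubspace A B T = ⊤ := by
    by_contra hne
    obtain ⟨f, hf, hker⟩ := Submodule.exists_le_ker_of_lt_top _ (lt_top_iff_ne_top.2 hne)
    have hfv : ∀ x, f x = (fun i => f (Pi.single i 1)) ⬝ᵥ x := fun x => by
      rw [LinearMap.pi_apply_eq_sum_univ f x, dotProduct]
      exact Finset.sum_congr rfl fun i _ => by
        rw [smul_eq_mul, mul_comm]; congr 2; funext j; simp [Pi.single_apply, eq_comm]
    have h0 := h (fun i => f (Pi.single i 1)) fun k => by
      refine dotProduct_eq_zero _ fun w => ?_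
      rw [← dotProduct_mulVec, ← hfv]
      refine hker ?_
      rcases le_total T (k + 1) with hk | hk
      · have := hT _ hk
        simp only [OrderHom.coe_mk] at this
        rw [this]
        exact pow_mulVec_mem_reachableSubspace A B k w
      · exact reachableSubspace_mono A B hk (pow_mulVec_mem_reachableSubspace A B k w)
    exact hf (LinearMap.ext fun x => by rw [hfv, h0]; simp)
  intro x₀ x₁
  obtain ⟨u, hu⟩ := exists_trajectory_eq A B x₀ (T := T) (y := x₁ - (A ^ T) *ᵥ x₀) (htop ▸ trivial)
  exact ⟨u, T, by rw [hu]; abel⟩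

/-! ### A controllable triangular realization -/

/-- The realization used for the controllability proof: numbers `rank i` on the diagonal, and `1` at
those free entries that lead from lower to higher rank. -/
def rankedRealization [DecidableEq ι] (A : Matrix ι ι Bool) (rank : ι → ℕ) : Matrix ι ι ℝ := fun i k =>
  (if i = k then (rank i : ℝ) else 0) + if A i k = true ∧ rank k < rank i then 1 else 0

theorem vecMul_rankedRealization [DecidableEq ι] (A : Matrix ι ι Bool) (rank : ι → ℕ) (f : ι → ℝ) (k : ι) :
    (f ᵥ* rankedRealization A rank) k =
      f k * rank k + ∑ i with A i k = true ∧ rank k < rank i, f i := by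
  simp [vecMul, dotProduct, rankedRealization, mul_add, Finset.sum_add_distrib, Finset.sum_filter]

/-- The 0-1 realization. -/
def boolRealization {α β : Type*} (B : Matrix α β Bool) : Matrix α β ℝ :=
  fun i j => if B i j = true then 1 else 0

/-- `hA` is the left eigenvector equation for the eigenvalue `rank m`. Read from high rank to low,
it propagates nonnegativity. Then, from low rank to high, entries vanish: at linked vertices by
`hB`, and at the others because the equation at a lower-ranked predecessor is a zero sum of
nonnegative terms. -/
theorem eq_zero_of_eigenvector {A : Matrix ι ι Bool} {B : Matrix ι κ Bool} {rank : ι → ℕ}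
    (h : ∀ i, (∃ j, B i j = true) ∨ ∃ k, A i k = true ∧ rank k < rank i)
    {f : ι → ℝ} {m : ι} (hinj : Function.Injective rank) (hm : 0 ≤ f m)
    (htop : ∀ i, rank m < rank i → f i = 0)
    (hB : f ᵥ* boolRealization B = 0)
    (hA : ∀ k, f k * ((rank m : ℝ) - rank k) = ∑ i with A i k = true ∧ rank k < rank i, f i) :
    f m = 0 := by
  -- `d` bounds how far the rank of `k` lies below that of `m`.
  have hnonneg : ∀ d k, rank m ≤ rank k + d → 0 ≤ f k := by
    intro d
    induction d using Nat.strong_induction_on with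
    | _ d ih =>
      intro k hk
      rcases lt_trichotomy (rank k) (rank m) with hlt | heq | hgt
      · have hpos : (0 : ℝ) < rank m - rank k := sub_pos.2 (by exact_mod_cast hlt)
        refine nonneg_of_mul_nonneg_left ?_ hpos
        rw [hA]
        refine Finset.sum_nonneg fun i hi => ?_
        have hi' := (Finset.mem_filter.1 hi).2.2
        exact ih (rank m - rank i) (by omega) i (by omega)
      · rwa [hinj heq]
      · exact (htop k hgt).ge
  have h0 : ∀ k, 0 ≤ f k := fun k => hnonneg (rank m) k (by omega)
  have hzero : ∀ r i, rank i = r → f i = 0 := by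
    intro r
    induction r using Nat.strong_induction_on with
    | _ r ih =>
      intro i hi
      rcases h i with ⟨j, hj⟩ | ⟨k, hik, hk⟩
      · have hs : ∑ i, f i * boolRealization B i j = 0 := congrFun hB j
        have := (Finset.sum_eq_zero_iff_of_nonneg fun i _ =>
          mul_nonneg (h0 i) (by unfold boolRealization; split_ifs <;> norm_num)).1 hs i
            (Finset.mem_univ i)
        simpa [boolRealization, hj] using this
      · have hs := hA k
        rw [ih (rank k) (hi ▸ hk) k rfl, zero_mul] at hs
        exact (Finset.sum_eq_zero_iff_of_nonneg fun i _ => h0 i).1 hs.symm i (by simp [hik, hk])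
  exact hzero _ m rfl

/-- A functional `f` annihilating all `A' ^ k * B'` is killed by induction on a bound for the ranks
in its support. If `N` is the top rank, `f ᵥ* A' - N • f` has smaller support, so it is zero and `f`
is a left eigenvector; its top coordinate then vanishes too. -/
theorem controllable_rankedRealization [Fintype κ] [DecidableEq ι] {A : Matrix ι ι Bool} {B : Matrix ι κ Bool} {rank : ι → ℕ}
    (hinj : Function.Injective rank)
    (h : ∀ i, (∃ j, B i j = true) ∨ ∃ k, A i k = true ∧ rank k < rank i) :
    Controllable (rankedRealization A rank) (boolRealization B) := by
  set A' := rankedRealization A rank with hA'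
  set B' := boolRealization B with hB'
  refine controllable_of_forall_vecMul _ _ fun f hf => ?_
  have key : ∀ N (f : ι → ℝ), (∀ k, f ᵥ* (A' ^ k * B') = 0) → (∀ i, N ≤ rank i → f i = 0) →
      f = 0 := by
    intro N
    induction N with
    | zero => exact fun f _ hN => funext fun i => hN i (Nat.zero_le _)
    | succ N ih =>
      intro f hf hN
      refine ih f hf fun i hi => ?_
      rcases hi.lt_or_eq with hlt | heq
      · exact hN i hlt
      have hg : f ᵥ* A' - (N : ℝ) • f = 0 := by
        refine ih _ (fun k => ?_) fun k hk => ?_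
        · rw [sub_vecMul, vecMul_vecMul, ← Matrix.mul_assoc, ← pow_succ', hf, smul_vecMul, hf]
          simp
        · rw [Pi.sub_apply, vecMul_rankedRealization, Finset.sum_eq_zero]
          · rcases hk.lt_or_eq with hlt | heq
            · simp [hN k hlt]
            · simp [heq, mul_comm]
          · exact fun i hi => hN i (by have := (Finset.mem_filter.1 hi).2.2; omega)
      -- Scaling by `f i` turns the top coordinate into a square, which supplies the required sign.
      have hfi := eq_zero_of_eigenvector (B := B) h (f := f i • f) (m := i) hinj (mul_self_nonneg _)
        (fun k hk => by simp [hN k (by omega)])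
        (by have := hf 0; rw [pow_zero, Matrix.one_mul] at this; rw [smul_vecMul, this, smul_zero])
        (fun k => by
          have := congrFun hg k
          rw [Pi.sub_apply, vecMul_rankedRealization] at this
          simp only [Pi.smul_apply, smul_eq_mul, Pi.zero_apply, ← Finset.mul_sum] at this ⊢
          rw [← heq]
          linear_combination (-f i) * this)
      simpa using hfi
  exact key ((Finset.univ.sup rank) + 1) f hf fun i hi => by
    have := Finset.le_sup (f := rank) (Finset.mem_univ i)
    omega

/-- Rank by the length of a shortest walk from a linked vertex, with ties broken by an enumeration.
-/
theorem exists_rank {A : Matrix ι ι Bool} {B : Matrix ι κ Bool}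
    (h : ∀ i, ∃ k j, B k j = true ∧ Reach (stateDigraph A) k i) :
    ∃ rank : ι → ℕ, Function.Injective rank ∧
      ∀ i, (∃ j, B i j = true) ∨ ∃ k, A i k = true ∧ rank k < rank i := by
  classical
  let lev : ℕ → ι → Prop := fun t => Nat.rec (motive := fun _ => ι → Prop)
    (fun i => ∃ j, B i j = true) (fun _ L i => ∃ k, A i k = true ∧ L k) t
  have hlev : ∀ i, ∃ t, lev t i := by
    intro i
    obtain ⟨k, j, hj, hr⟩ := h i
    induction hr with
    | refl => exact ⟨0, j, hj⟩
    | tail _ hbc ih => exact ⟨ih.choose + 1, _, hbc, ih.choose_spec⟩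
  let e := Fintype.equivFin ι
  -- As `e i` is below the cardinality, the level dominates the order and the residue recovers `i`.
  refine ⟨fun i => Fintype.card ι * Nat.find (hlev i) + e i, fun i k hik => ?_, fun i => ?_⟩
  · have := congrArg (· % Fintype.card ι) hik
    simp only [Nat.mul_add_mod, Nat.mod_eq_of_lt (e _).2] at this
    exact e.injective (Fin.ext this)
  · rcases hf : Nat.find (hlev i) with _ | t
    · exact Or.inl ((Nat.find_eq_zero (hlev i)).1 hf)
    · right
      have hspec := Nat.find_spec (hlev i)
      rw [hf] at hspec
      obtain ⟨k, hik, hk⟩ := hspec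
      refine ⟨k, hik, ?_⟩
      have h1 : Nat.find (hlev k) ≤ t := Nat.find_min' _ hk
      have h2 := Nat.mul_le_mul_left (Fintype.card ι) h1
      have := (e k).2
      simp only [hf, Nat.mul_succ]
      omega

theorem structurallyControllable_iff [Fintype κ] {A : Matrix ι ι Bool} {B : Matrix ι κ Bool}
    (hdiag : ∀ i, A i i = true) : StructurallyControllable A B ↔
      ∀ N, IsSourceSCC (stateDigraph A) N → ∃ i ∈ N, ∃ j, B i j = true := by
  classical
  constructor
  · rintro ⟨A', B', hA', hB', hc⟩ N hN
    by_contra! hno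
    obtain ⟨hs, hcl⟩ := isSourceSCC_iff.1 hN
    -- The all-ones state cannot be reached from zero, since the coordinates in `N` remain zero.
    obtain ⟨u, T, hT⟩ := hc 0 1
    have hzero : ∀ t, ∀ i ∈ N, trajectory A' B' 0 u t i = 0 := by
      intro t
      induction t with
      | zero => simp [trajectory]
      | succ t ih =>
        intro i hi
        simp only [trajectory, Pi.add_apply, mulVec, dotProduct]
        rw [Finset.sum_eq_zero, Finset.sum_eq_zero, add_zero]
        · intro j _
          rw [hB' i j (by simpa using hno i hi j), zero_mul]
        · intro k _
          by_cases hk : A i k = true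
          · rw [ih k (hcl i hi k hk), mul_zero]
          · rw [hA' i k (by simpa using hk), zero_mul]
    obtain ⟨i, hi⟩ := hs.1
    have := hzero T i hi
    rw [hT] at this
    exact one_ne_zero this
  · intro h
    have hreach : ∀ i, ∃ k j, B k j = true ∧ Reach (stateDigraph A) k i := by
      by_contra hne
      obtain ⟨i, hi⟩ := not_forall.1 hne
      obtain ⟨N, hNU, hN⟩ := exists_isSourceSCC_subset (G := stateDigraph A)
        (U := {i | ¬ ∃ k j, B k j = true ∧ Reach (stateDigraph A) k i}) ⟨i, hi⟩
        (fun w hw v hvw ⟨k, j, hj, hk⟩ => hw ⟨k, j, hj, hk.tail hvw⟩)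
      obtain ⟨i, hi, j, hj⟩ := h N hN
      exact hNU hi ⟨i, j, hj, .refl⟩
    obtain ⟨rank, hinj, hrank⟩ := exists_rank hreach
    refine ⟨rankedRealization A rank, boolRealization B, fun i j hij => ?_, fun i j hij => ?_,
      controllable_rankedRealization hinj hrank⟩
    · have hne : i ≠ j := by rintro rfl; simp [hdiag] at hij
      simp [rankedRealization, hne, hij]
    · simp [boolRealization, hij]

/-! ### Removal sets and their costs -/

theorem isInputRemovalSet_iff [Fintype κ] [DecidableEq κ] {A : Matrix ι ι Bool} {B : Matrix ι κ Bool}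
    (hdiag : ∀ i, A i i = true) {J : Finset κ} : IsInputRemovalSet A B J ↔
      ∃ N, IsSourceSCC (stateDigraph A) N ∧ ∀ i ∈ N, ∀ j, B i j = true → j ∈ J := by
  rw [IsInputRemovalSet, structurallyControllable_iff hdiag]
  simp only [deleteInputs, Matrix.submatrix_apply, id_eq, Subtype.exists]
  push Not
  refine exists_congr fun N => and_congr_right fun _ => forall₂_congr fun i _ =>
    forall_congr' fun j => ⟨fun h hj => by_contra fun hJ => h hJ hj, fun h hJ hj => hJ (h hj)⟩

open Classical in
theorem adjacentInputCost_eq [Fintype κ] (A : Matrix ι ι Bool) (B : Matrix ι κ Bool) (c : κ → ℝ)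
    (N : Set ι) : adjacentInputCost A B c N = ∑ j with ∃ i ∈ N, B i j = true, c j := by
  unfold adjacentInputCost
  congr 1
  ext j
  simp [inNeighbors, systemDigraph]

theorem adjacentInputCost_le_sum [Fintype κ] [DecidableEq κ] {A : Matrix ι ι Bool} {B : Matrix ι κ Bool}
    {c : κ → ℝ} (hc : ∀ j, 0 ≤ c j) {N : Set ι} {J : Finset κ}
    (hJ : ∀ i ∈ N, ∀ j, B i j = true → j ∈ J) : adjacentInputCost A B c N ≤ ∑ j ∈ J, c j := by
  classical
  rw [adjacentInputCost_eq]
  refine Finset.sum_le_sum_of_subset_of_nonneg (fun j hj => ?_) fun j _ _ => hc j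
  obtain ⟨i, hi, hij⟩ := (Finset.mem_filter.1 hj).2
  exact hJ i hi j hij

theorem isLeast_feasibleCosts_of_isLeast_sourceCosts [Fintype κ] [DecidableEq κ] {A : Matrix ι ι Bool}
    {B : Matrix ι κ Bool} {c : κ → ℝ} (hdiag : ∀ i, A i i = true) (hc : ∀ j, 0 ≤ c j) {v : ℝ}
    (hv : IsLeast (sourceCosts A B c) v) : IsLeast (feasibleCosts A B c) v := by
  classical
  obtain ⟨⟨N, hN, rfl⟩, hmin⟩ := hv
  refine ⟨⟨Finset.univ.filter fun j => ∃ i ∈ N, B i j = true, ?_, ?_⟩, ?_⟩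
  · exact (isInputRemovalSet_iff hdiag).2 ⟨N, hN, fun i hi j hij => by simpa using ⟨i, hi, hij⟩⟩
  · rw [adjacentInputCost_eq]
  · rintro r ⟨J, hJ, rfl⟩
    obtain ⟨M, hM, hMJ⟩ := (isInputRemovalSet_iff hdiag).1 hJ
    exact (hmin ⟨M, hM, rfl⟩).trans (adjacentInputCost_le_sum hc hMJ)

theorem exists_isLeast_sourceCosts [Fintype κ] [Nonempty ι] (A : Matrix ι ι Bool) (B : Matrix ι κ Bool)
    (c : κ → ℝ) : ∃ v, IsLeast (sourceCosts A B c) v := by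
  obtain ⟨N, -, hN⟩ := exists_isSourceSCC_subset (G := stateDigraph A) Set.univ_nonempty
    fun _ _ _ _ => trivial
  obtain ⟨M, hM, hmin⟩ := Set.exists_min_image {N | IsSourceSCC (stateDigraph A) N}
    (adjacentInputCost A B c) (Set.toFinite _) ⟨N, hN⟩
  exact ⟨_, ⟨M, hM, rfl⟩, by rintro r ⟨M', hM', rfl⟩; exact hmin M' hM'⟩

end Control

/-! ### Reasoning about programs -/

namespace Store

variable (s : Store) (r v a i j r' : ℕ) (x : ℝ)

theorem setN_nreg : (s.setN r v).nreg r' = if r' = r then v else s.nreg r' := rfl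
theorem setN_narr : (s.setN r v).narr = s.narr := rfl
theorem setN_rreg : (s.setN r v).rreg = s.rreg := rfl
theorem setN_rarr : (s.setN r v).rarr = s.rarr := rfl
theorem setNArr_nreg : (s.setNArr a i j v).nreg = s.nreg := rfl
theorem setNArr_narr (a' i' j' : ℕ) : (s.setNArr a i j v).narr a' i' j' =
    if a' = a ∧ i' = i ∧ j' = j then v else s.narr a' i' j' := rfl
theorem setNArr_rreg : (s.setNArr a i j v).rreg = s.rreg := rfl
theorem setNArr_rarr : (s.setNArr a i j v).rarr = s.rarr := rfl
theorem setR_nreg : (s.setR r x).nreg = s.nreg := rfl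
theorem setR_narr : (s.setR r x).narr = s.narr := rfl
theorem setR_rreg : (s.setR r x).rreg r' = if r' = r then x else s.rreg r' := rfl

end Store

/-! ### Frames: the memory that a program leaves untouched -/

namespace Instr

/-- The instruction writes to natural register `r`. -/
def writesReg (r : ℕ) : Instr → Bool
  | const r' _ | copy r' _ | succ r' | pred r' | load r' _ _ _ => r' == r
  | _ => false

/-- The instruction writes to array `a` of natural numbers. -/
def writesArr (a : ℕ) : Instr → Bool
  | store a' _ _ _ => a' == a
  | _ => false

/-- The instruction writes to real register `x`. -/
def writesRReg (x : ℕ) : Instr → Bool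
  | rcopy x' _ | rplus x' _ | rload x' _ _ => x' == x
  | _ => false

/-- The instruction writes to array `a` of real numbers. -/
def writesRArr (a : ℕ) : Instr → Bool
  | rstore a' _ _ => a' == a
  | _ => false

end Instr

/-- Some instruction of the program satisfies `p`. -/
def Prog.any (p : Instr → Bool) : Prog → Bool
  | .skip => false
  | .instr I => p I
  | .seq P Q | .ifLe _ _ P Q | .ifRLe _ _ P Q => P.any p || Q.any p
  | .whileLt _ _ P => P.any p

/-- The memories `s` and `s'` agree at all registers and arrays that `P` does not write to. -/
structure Frame (P : Prog) (s s' : Store) : Prop where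
  nreg : ∀ r, P.any (Instr.writesReg r) = false → s'.nreg r = s.nreg r
  narr : ∀ a, P.any (Instr.writesArr a) = false → s'.narr a = s.narr a
  rreg : ∀ x, P.any (Instr.writesRReg x) = false → s'.rreg x = s.rreg x
  rarr : ∀ a, P.any (Instr.writesRArr a) = false → s'.rarr a = s.rarr a

theorem Frame.refl (P : Prog) (s : Store) : Frame P s s :=
  ⟨fun _ _ => rfl, fun _ _ => rfl, fun _ _ => rfl, fun _ _ => rfl⟩

theorem Frame.trans {P : Prog} {s₁ s₂ s₃ : Store} (h : Frame P s₁ s₂) (h' : Frame P s₂ s₃) :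
    Frame P s₁ s₃ :=
  ⟨fun r hr => (h'.nreg r hr).trans (h.nreg r hr), fun r hr => (h'.narr r hr).trans (h.narr r hr),
    fun r hr => (h'.rreg r hr).trans (h.rreg r hr), fun r hr => (h'.rarr r hr).trans (h.rarr r hr)⟩

theorem Frame.mono {P Q : Prog} (hPQ : ∀ p, Q.any p = false → P.any p = false) {s s' : Store}
    (h : Frame P s s') : Frame Q s s' :=
  ⟨fun r hr => h.nreg r (hPQ _ hr), fun r hr => h.narr r (hPQ _ hr),
    fun r hr => h.rreg r (hPQ _ hr), fun r hr => h.rarr r (hPQ _ hr)⟩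

theorem frame_exec (I : Instr) (s : Store) : Frame (.instr I) s (I.exec s) := by
  constructor <;> intro r hr <;> cases I <;> first
    | rfl
    | (have hr' := Ne.symm (beq_eq_false_iff_ne.1 hr)
       simp [Instr.exec, Store.setN, Store.setNArr, Store.setR, Store.setRArr, hr'])

/-- With the program fixed, the frame conditions are decided by evaluation, so loop invariants need
not mention what the loop never writes. -/
theorem Runs.frame {P : Prog} {s s' : Store} {t : ℕ} (h : Runs P s t s') : Frame P s s' := by
  induction h with
  | skip s => exact .refl _ _
  | instr I s => exact frame_exec I s
  | seq _ _ ih ih' =>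
    exact (ih.mono fun p hp => by simp_all [Prog.any]).trans
      (ih'.mono fun p hp => by simp_all [Prog.any])
  | ifLeTrue _ _ ih | ifLeFalse _ _ ih | ifRLeTrue _ _ ih | ifRLeFalse _ _ ih =>
    exact ih.mono fun p hp => by simp_all [Prog.any]
  | whileDone _ => exact .refl _ _
  | whileStep _ _ _ ih ih' => exact (ih.mono fun p hp => by simpa [Prog.any] using hp).trans ih'

/-! ### Program rules with step counts -/

/-- Total correctness: started on `s`, the program `P` halts, and the number of steps and the final
memory satisfy `Q`. -/
def Ok (P : Prog) (s : Store) (Q : ℕ → Store → Prop) : Prop :=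
  ∃ t s', Runs P s t s' ∧ Q t s'

variable {P P' : Prog} {s : Store} {Q : ℕ → Store → Prop}

theorem ok_skip : Ok .skip s Q ↔ Q 0 s :=
  ⟨fun ⟨_, _, h, hQ⟩ => by cases h; exact hQ, fun h => ⟨_, _, .skip s, h⟩⟩

theorem ok_instr {I : Instr} : Ok (.instr I) s Q ↔ Q 1 (I.exec s) :=
  ⟨fun ⟨_, _, h, hQ⟩ => by cases h; exact hQ, fun h => ⟨_, _, .instr I s, h⟩⟩

theorem ok_seq : Ok (.seq P P') s Q ↔ Ok P s fun t s' => Ok P' s' fun t' => Q (t + t') := by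
  constructor
  · rintro ⟨_, _, h, hQ⟩
    cases h with
    | seq h h' => exact ⟨_, _, h, _, _, h', hQ⟩
  · rintro ⟨_, _, h, _, _, h', hQ⟩
    exact ⟨_, _, .seq h h', hQ⟩

theorem ok_ifLe {r r' : ℕ} : Ok (.ifLe r r' P P') s Q ↔
    (s.nreg r ≤ s.nreg r' → Ok P s fun t => Q (t + 1)) ∧
      (¬ s.nreg r ≤ s.nreg r' → Ok P' s fun t => Q (t + 1)) := by
  constructor
  · rintro ⟨_, _, h, hQ⟩
    cases h with
    | ifLeTrue hr h => exact ⟨fun _ => ⟨_, _, h, hQ⟩, fun hn => absurd hr hn⟩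
    | ifLeFalse hr h => exact ⟨fun hn => absurd hn hr, fun _ => ⟨_, _, h, hQ⟩⟩
  · rintro ⟨h, h'⟩
    by_cases hr : s.nreg r ≤ s.nreg r'
    · obtain ⟨_, _, h, hQ⟩ := h hr
      exact ⟨_, _, .ifLeTrue hr h, hQ⟩
    · obtain ⟨_, _, h, hQ⟩ := h' hr
      exact ⟨_, _, .ifLeFalse hr h, hQ⟩

theorem ok_ifRLe {x y : ℕ} : Ok (.ifRLe x y P P') s Q ↔
    (s.rreg x ≤ s.rreg y → Ok P s fun t => Q (t + 1)) ∧
      (¬ s.rreg x ≤ s.rreg y → Ok P' s fun t => Q (t + 1)) := by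
  constructor
  · rintro ⟨_, _, h, hQ⟩
    cases h with
    | ifRLeTrue hr h => exact ⟨fun _ => ⟨_, _, h, hQ⟩, fun hn => absurd hr hn⟩
    | ifRLeFalse hr h => exact ⟨fun hn => absurd hn hr, fun _ => ⟨_, _, h, hQ⟩⟩
  · rintro ⟨h, h'⟩
    by_cases hr : s.rreg x ≤ s.rreg y
    · obtain ⟨_, _, h, hQ⟩ := h hr
      exact ⟨_, _, .ifRLeTrue hr h, hQ⟩
    · obtain ⟨_, _, h, hQ⟩ := h' hr
      exact ⟨_, _, .ifRLeFalse hr h, hQ⟩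

theorem Ok.mono {Q' : ℕ → Store → Prop} (h : Ok P s Q)
    (hQ : ∀ t s', Frame P s s' → Q t s' → Q' t s') : Ok P s Q' := by
  obtain ⟨t, s', hr, hq⟩ := h
  exact ⟨t, s', hr, hQ t s' hr.frame hq⟩

/-- The rule for loops; the invariant `I m` includes that the potential is `m`, and the potential pays
for the steps. -/
theorem ok_while_potential {r r' : ℕ} (I : ℕ → Store → Prop) {m : ℕ} (hI : I m s)
    (hstep : ∀ m s', Frame P s s' → I m s' → s'.nreg r < s'.nreg r' →
      Ok P s' fun t s'' => ∃ m', I m' s'' ∧ t + 1 + m' ≤ m)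
    (hQ : ∀ t m' s', Frame P s s' → I m' s' → ¬ s'.nreg r < s'.nreg r' → t + m' ≤ m + 1 → Q t s') :
    Ok (.whileLt r r' P) s Q := by
  -- Each round lowers the potential by at least one, so termination and the time bound come from
  -- one induction; the extra `1` pays for the final failed test.
  have key : ∀ m s', Frame P s s' → I m s' → ∃ t m' s'', Runs (.whileLt r r' P) s' t s'' ∧
      I m' s'' ∧ ¬ s''.nreg r < s''.nreg r' ∧ t + m' ≤ m + 1 := by
    intro m
    induction m using Nat.strong_induction_on with
    | _ m ih =>
      intro s' hF hI'
      by_cases hlt : s'.nreg r < s'.nreg r'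
      · obtain ⟨t, s'', hrun, m', hI'', ht⟩ := hstep m s' hF hI' hlt
        obtain ⟨t', m'', s₃, hrun', hI₃, hn, ht'⟩ :=
          ih m' (by omega) s'' (hF.trans hrun.frame) hI''
        exact ⟨_, _, _, .whileStep hlt hrun hrun', hI₃, hn, by omega⟩
      · exact ⟨1, m, s', .whileDone hlt, hI', hlt, by omega⟩
  obtain ⟨t, m', s', hrun, hI', hn, ht⟩ := key m s (.refl _ _) hI
  exact ⟨t, s', hrun,
    hQ t m' s' (hrun.frame.mono fun p hp => by simpa [Prog.any] using hp) hI' hn ht⟩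

/-- The rule for loops with a potential that is a function of the memory. -/
theorem ok_while {r r' : ℕ} (I : Store → Prop) (Φ : Store → ℕ) (hI : I s)
    (hstep : ∀ s', Frame P s s' → I s' → s'.nreg r < s'.nreg r' →
      Ok P s' fun t s'' => I s'' ∧ t + 1 + Φ s'' ≤ Φ s')
    (hQ : ∀ t s', Frame P s s' → I s' → ¬ s'.nreg r < s'.nreg r' → t + Φ s' ≤ Φ s + 1 → Q t s') :
    Ok (.whileLt r r' P) s Q := by
  refine ok_while_potential (fun m s' => I s' ∧ m = Φ s') ⟨hI, rfl⟩ ?_ ?_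
  · rintro _ s' hF ⟨hI', rfl⟩ hlt
    exact (hstep s' hF hI' hlt).mono fun t s'' _ h => ⟨_, ⟨h.1, rfl⟩, h.2⟩
  · rintro t _ s' hF ⟨hI', rfl⟩ hn ht
    exact hQ t s' hF hI' hn ht

local infixr:60 " ;; " => Prog.seq

/-! ### The program

Natural registers: `0` number of states, `2` the constant `0`, `3` the current candidate `v`, `4`/`5`
head and tail of the forward queue, `6`/`7` head and tail of the backward queue, `8` the vertex that
is being expanded, `9` and `15` counters, `12` the flag for an ancestor that is not a descendant,
`13` the stamp `v + 1`, `14` the stamp of the best component, `18` the constant `1`.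
Arrays: `4`/`5` marks and queue of the forward search, `6`/`7` those of the backward search, `8` the
stamps of the inputs. Real registers: `0` the best cost, `1` the current cost, `3` the constant `0`. -/

namespace Prog

/-- `const`. -/
abbrev const (r k : ℕ) : Prog := .instr (.const r k)
/-- `copy`. -/
abbrev copy (r s : ℕ) : Prog := .instr (.copy r s)
/-- `succ`. -/
abbrev succ (r : ℕ) : Prog := .instr (.succ r)
/-- `load`. -/
abbrev load (r a i j : ℕ) : Prog := .instr (.load r a i j)
/-- `store`. -/
abbrev store (a i j r : ℕ) : Prog := .instr (.store a i j r)
/-- `rcopy`. -/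
abbrev rcopy (x y : ℕ) : Prog := .instr (.rcopy x y)
/-- `rplus`. -/
abbrev rplus (x y : ℕ) : Prog := .instr (.rplus x y)
/-- `rload`. -/
abbrev rload (x a i : ℕ) : Prog := .instr (.rload x a i)

end Prog

open Prog in
/-- Add to real register `1` the costs of the inputs linked to the vertex in register `8` that do not
carry the current stamp yet, and stamp them. -/
def costLoop : Prog :=
  load 16 1 8 2 ;; const 15 0 ;;
  whileLt 15 16 (load 17 2 8 15 ;; load 19 8 17 2 ;;
    ifLe 13 19 skip (Prog.store 8 17 2 13 ;; rload 2 0 17 ;; rplus 1 2) ;;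
    Prog.succ 15)

open Prog in
/-- Put the unmarked successors of the vertex in register `8` into the forward queue. -/
def forwardScan : Prog :=
  const 9 0 ;;
  whileLt 9 0 (load 10 0 9 8 ;; load 11 4 9 2 ;;
    ifLe 18 10 (ifLe 11 2 (Prog.store 4 9 2 18 ;; Prog.store 5 5 2 9 ;; Prog.succ 5) skip) skip ;;
    Prog.succ 9)

open Prog in
/-- Put the unmarked predecessors of the vertex in register `8` into the backward queue, if they carry
the mark of the forward search; raise the flag if some predecessor does not. -/
def backwardScan : Prog :=
  const 9 0 ;;
  whileLt 9 0 (load 10 0 8 9 ;; load 11 4 9 2 ;; load 20 6 9 2 ;;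
    ifLe 18 10 (ifLe 11 2 (const 12 1)
      (ifLe 20 2 (Prog.store 6 9 2 13 ;; Prog.store 7 7 2 9 ;; Prog.succ 7) skip)) skip ;;
    Prog.succ 9)

open Prog in
/-- Mark all descendants of the vertex in register `3`. -/
def forwardSearch : Prog :=
  Prog.store 4 3 2 18 ;; Prog.store 5 5 2 3 ;; Prog.succ 5 ;;
  whileLt 4 5 (load 8 5 4 2 ;; Prog.succ 4 ;; forwardScan)

open Prog in
/-- Mark the ancestors of the vertex in register `3` with a new stamp, as long as they are
descendants, and sum up the costs of the inputs linked to them. -/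
def backwardSearch : Prog :=
  copy 13 3 ;; Prog.succ 13 ;; const 12 0 ;; rcopy 1 3 ;;
  Prog.store 6 3 2 13 ;; Prog.store 7 7 2 3 ;; Prog.succ 7 ;;
  whileLt 6 7 (load 8 7 6 2 ;; Prog.succ 6 ;; backwardScan ;; costLoop)

open Prog in
/-- Remember the current component and its cost. -/
def updateBest : Prog := copy 14 13 ;; rcopy 0 1

open Prog in
/-- Treat the candidate in register `3`. -/
def candidateStep : Prog :=
  load 10 4 3 2 ;;
  ifLe 10 2
    (forwardSearch ;; backwardSearch ;;
      ifLe 12 2 (ifLe 14 2 updateBest (ifRLe 1 0 updateBest skip)) skip) skip ;;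
  Prog.succ 3

open Prog in
/-- Put the inputs linked to the vertex in register `9` into the output set. -/
def outputLinks : Prog :=
  load 16 1 9 2 ;; const 15 0 ;;
  whileLt 15 16 (load 17 2 9 15 ;; Prog.store 3 17 2 18 ;; Prog.succ 15)

open Prog in
/-- Put the inputs linked to the best component into the output set. -/
def outputBest : Prog :=
  const 9 0 ;;
  whileLt 9 0 (load 11 6 9 2 ;;
    ifLe 11 14 (ifLe 14 11 outputLinks skip) skip ;;
    Prog.succ 9)

open Prog in
/-- The algorithm for the minimal cost actuator deletion problem. -/
def deletionProgram : Prog :=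
  const 18 1 ;; whileLt 3 0 candidateStep ;; outputBest

/-! ### Correctness of the loops -/

section Loops

variable {n q : ℕ} {A : Matrix (Fin n) (Fin n) Bool} {B : Matrix (Fin n) (Fin q) Bool}
  {c : Fin q → ℝ}

/-- The memory holds the problem data and the constants. -/
structure HasInput (A : Matrix (Fin n) (Fin n) Bool) (B : Matrix (Fin n) (Fin q) Bool)
    (c : Fin q → ℝ) (s : Store) : Prop where
  size : s.nreg 0 = n
  zero : s.nreg 2 = 0
  one : s.nreg 18 = 1
  rzero : s.rreg 3 = 0
  adj : ∀ i j : Fin n, s.narr 0 i j = (A i j).toNat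
  length : ∀ i : Fin n, s.narr 1 i 0 = (inputsOf B i).length
  links : ∀ (i : Fin n) t (h : t < (inputsOf B i).length), s.narr 2 i t = (inputsOf B i)[t]
  cost : ∀ j : Fin q, s.rarr 0 j = c j

theorem HasInput.congr {s s' : Store} (h : HasInput A B c s) (h0 : s'.nreg 0 = s.nreg 0)
    (h2 : s'.nreg 2 = s.nreg 2) (h18 : s'.nreg 18 = s.nreg 18) (hr : s'.rreg 3 = s.rreg 3)
    (ha : s'.narr 0 = s.narr 0) (ha1 : s'.narr 1 = s.narr 1) (ha2 : s'.narr 2 = s.narr 2)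
    (hra : s'.rarr 0 = s.rarr 0) : HasInput A B c s' :=
  ⟨h0 ▸ h.size, h2 ▸ h.zero, h18 ▸ h.one, hr ▸ h.rzero, ha ▸ h.adj, ha1 ▸ h.length, ha2 ▸ h.links,
    hra ▸ h.cost⟩

/-- The program does not write to the problem data and the constants. -/
def Prog.keepsInput (P : Prog) : Bool :=
  !(P.any (Instr.writesReg 0) || P.any (Instr.writesReg 2) || P.any (Instr.writesReg 18) ||
    P.any (Instr.writesRReg 3) || P.any (Instr.writesArr 0) || P.any (Instr.writesArr 1) ||
    P.any (Instr.writesArr 2) || P.any (Instr.writesRArr 0))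

theorem HasInput.frame {P : Prog} {s s' : Store} (h : HasInput A B c s) (hF : Frame P s s')
    (hP : P.keepsInput = true) : HasInput A B c s' := by
  simp only [Prog.keepsInput, Bool.not_eq_true', Bool.or_eq_false_iff] at hP
  obtain ⟨⟨⟨⟨⟨⟨⟨h0, h2⟩, h18⟩, hr⟩, ha⟩, ha1⟩, ha2⟩, hra⟩ := hP
  exact h.congr (hF.nreg _ h0) (hF.nreg _ h2) (hF.nreg _ h18) (hF.rreg _ hr) (hF.narr _ ha)
    (hF.narr _ ha1) (hF.narr _ ha2) (hF.rarr _ hra)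

theorem mem_inputsOf {i : Fin n} {j : Fin q} : j ∈ inputsOf B i ↔ B i j = true := by
  simp [inputsOf]

/-- The sum of the costs of the inputs with stamp `σ`. -/
def stampedCost (c : Fin q → ℝ) (σ : ℕ) (s : Store) : ℝ :=
  ∑ j ∈ Finset.univ.filter fun j : Fin q => s.narr 8 j 0 = σ, c j

/-- The stamp in register `13` marks the inputs already counted for the current component, so an
input linked to several of its vertices is paid once. -/
theorem costLoop_ok {s : Store} (hs : HasInput A B c s) (x : Fin n) (hx : s.nreg 8 = x)
    (hstamp : ∀ j : Fin q, s.narr 8 j 0 ≤ s.nreg 13)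
    (hcost : s.rreg 1 = stampedCost c (s.nreg 13) s) :
    Ok costLoop s fun t s' => (∀ j : Fin q, s'.narr 8 j 0 ≤ s.nreg 13) ∧
      (∀ j : Fin q, s'.narr 8 j 0 = s.nreg 13 ↔ s.narr 8 j 0 = s.nreg 13 ∨ B x j = true) ∧
      s'.rreg 1 = stampedCost c (s.nreg 13) s' ∧
      t ≤ 8 * (inputsOf B x).length + 3 := by
  unfold costLoop
  simp only [ok_seq, ok_instr, Instr.exec]
  set l := inputsOf B x with hl
  refine ok_while
    (fun s' => s'.nreg 15 ≤ l.length ∧ (∀ j : Fin q, s'.narr 8 j 0 ≤ s.nreg 13) ∧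
      (∀ j : Fin q, s'.narr 8 j 0 = s.nreg 13 ↔
        s.narr 8 j 0 = s.nreg 13 ∨ j ∈ l.take (s'.nreg 15)) ∧
      s'.rreg 1 = stampedCost c (s.nreg 13) s')
    -- A round takes at most seven steps in the body and one for the loop test.
    (fun s' => 8 * (l.length - s'.nreg 15)) ?_ ?_ ?_
  · simpa [Store.setN_nreg, Store.setN_narr, Store.setN_rreg] using ⟨hstamp, hcost⟩
  · rintro s' hF ⟨hle, h1, h2, h3⟩ hlt
    have hs' : HasInput A B c s' := (hs.congr (by rfl) (by rfl) (by rfl) (by rfl) (by rfl) (by rfl)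
      (by rfl) (by rfl)).frame hF (by rfl)
    have h8 : s'.nreg 8 = x := (hF.nreg 8 (by rfl)).trans hx
    have h13 : s'.nreg 13 = s.nreg 13 := hF.nreg 13 (by rfl)
    have h16 : s'.nreg 16 = l.length := by
      rw [hF.nreg 16 (by rfl)]
      simp [Store.setN_nreg, hx, hs.zero, hs.length, hl]
    rw [h16] at hlt
    have hj : s'.narr 2 (s'.nreg 8) (s'.nreg 15) = (l[s'.nreg 15] : Fin q) := by
      rw [h8]; exact hs'.links x _ hlt
    set k := s'.nreg 15 with hk
    have htake : ∀ j, j ∈ l.take (k + 1) ↔ j ∈ l.take k ∨ j = l[k] := fun j => by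
      rw [← List.take_concat_get' l k hlt, List.mem_append, List.mem_singleton]
    simp only [ok_seq, ok_instr, ok_ifLe, ok_skip, Instr.exec, Store.setN_nreg, Store.setN_narr,
      Store.setN_rreg, Store.setN_rarr, Store.setNArr_nreg, Store.setNArr_narr, Store.setNArr_rreg,
      Store.setNArr_rarr, Store.setR_nreg, Store.setR_narr, Store.setR_rreg,
      reduceIte, Nat.reduceEqDiff, hj, h13, hs'.zero]
    set y := l[k] with hy
    refine ⟨fun hold => ?_, fun hold => ?_⟩
    · have hyold : s'.narr 8 y 0 = s.nreg 13 := le_antisymm (h1 y) hold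
      refine ⟨⟨by omega, h1, fun j => ?_, h3⟩, by omega⟩
      rw [htake, h2]
      have := (h2 y).1 hyold
      constructor
      · rintro (h | h)
        exacts [.inl h, .inr (.inl h)]
      · rintro (h | h | rfl)
        exacts [.inl h, .inr h, this]
    · have hne : s'.narr 8 y 0 ≠ s.nreg 13 := by omega
      have hnew : ∀ j : Fin q, (if True ∧ (j : ℕ) = y ∧ True then s.nreg 13 else s'.narr 8 j 0)
          = s.nreg 13 ↔ s'.narr 8 j 0 = s.nreg 13 ∨ j = y := fun j => by
        by_cases hjy : j = y
        · simp [hjy]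
        · simp [hjy, Fin.val_inj]
      refine ⟨⟨by omega, fun j => ?_, fun j => ?_, ?_⟩, by omega⟩
      · split_ifs
        exacts [le_rfl, h1 j]
      · rw [hnew, htake, h2, or_assoc]
      · simp only [stampedCost, Store.setNArr_narr, Store.setR_narr, Store.setN_narr, hnew]
        rw [stampedCost] at h3
        rw [Finset.filter_or, Finset.sum_union, h3, hs'.cost]
        · simp [Finset.filter_eq']
        · rw [Finset.disjoint_filter]
          rintro j - h rfl
          exact hne h
  · rintro t s' hF ⟨hle, h1, h2, h3⟩ hlt ht
    have h16 : s'.nreg 16 = l.length := by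
      rw [hF.nreg 16 (by rfl)]
      simp [Store.setN_nreg, hx, hs.zero, hs.length, hl]
    rw [h16] at hlt
    refine ⟨h1, fun j => ?_, h3, ?_⟩
    · rw [h2, List.take_of_length_le (by omega), mem_inputsOf]
    · simp only [Store.setN_nreg, reduceIte] at ht
      omega

/-- The list `L` of vertices is stored in array `a`, with its length in register `r`; array `m`
marks its members. -/
structure Queue (m a r : ℕ) (L : List (Fin n)) (s : Store) : Prop where
  nodup : L.Nodup
  length : s.nreg r = L.length
  get : ∀ p (h : p < L.length), s.narr a p 0 = L[p]
  mark : ∀ w : Fin n, s.narr m w 0 = 0 ↔ w ∉ L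

theorem Queue.congr {m a r : ℕ} {L : List (Fin n)} {s s' : Store} (h : Queue m a r L s)
    (hr : s'.nreg r = s.nreg r) (ha : s'.narr a = s.narr a) (hm : s'.narr m = s.narr m) :
    Queue m a r L s' :=
  ⟨h.nodup, hr ▸ h.length, ha ▸ h.get, hm ▸ h.mark⟩

theorem Queue.length_le {m a r : ℕ} {L : List (Fin n)} {s : Store} (h : Queue m a r L s) :
    L.length ≤ n := by
  simpa using h.nodup.length_le_card

theorem Queue.push {m a r : ℕ} {L : List (Fin n)} {s s' : Store} (h : Queue m a r L s) {w : Fin n}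
    (hw : w ∉ L) {σ : ℕ} (hσ : σ ≠ 0) (hr : s'.nreg r = s.nreg r + 1)
    (ha : ∀ p, s'.narr a p 0 = if p = s.nreg r then (w : ℕ) else s.narr a p 0)
    (hm : ∀ p, s'.narr m p 0 = if p = (w : ℕ) then σ else s.narr m p 0) :
    Queue m a r (L ++ [w]) s' := by
  refine ⟨?_, by simp [hr, h.length], fun p hp => ?_, fun u => ?_⟩
  · rw [List.nodup_append]
    refine ⟨h.nodup, by simp, ?_⟩
    rintro a ha b hb rfl
    simp only [List.mem_singleton] at hb
    exact hw (hb ▸ ha)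
  · rw [ha, h.length]
    split_ifs with hpl
    · subst hpl; simp
    · have hp' : p < L.length := by simp at hp; omega
      rw [List.getElem_append_left hp', h.get p hp']
  · rw [hm]
    by_cases huw : u = w
    · simp [huw, hσ]
    · simp [huw, Fin.val_inj, h.mark]

theorem adj_iff {s : Store} (hs : HasInput A B c s) (i j : Fin n) :
    1 ≤ s.narr 0 i j ↔ A i j = true := by
  rw [hs.adj]; cases A i j <;> simp

theorem forwardScan_ok {s : Store} (hs : HasInput A B c s) (x : Fin n) (hx : s.nreg 8 = x)
    {L : List (Fin n)} (hL : Queue 4 5 5 L s) :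
    Ok forwardScan s fun t s' => t ≤ 9 * n + 2 ∧ ∃ T, Queue 4 5 5 (L ++ T) s' ∧
      (∀ w ∈ T, A w x = true) ∧ ∀ w, A w x = true → w ∈ L ++ T := by
  unfold forwardScan
  simp only [ok_seq, ok_instr, Instr.exec]
  refine ok_while
    (fun s' => s'.nreg 9 ≤ n ∧ ∃ T, Queue 4 5 5 (L ++ T) s' ∧
      (∀ w ∈ T, A w x = true) ∧ ∀ w : Fin n, (w : ℕ) < s'.nreg 9 → A w x = true → w ∈ L ++ T)
    (fun s' => 9 * (n - s'.nreg 9)) ?_ ?_ ?_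
  · exact ⟨by simp [Store.setN_nreg], [], by rw [List.append_nil]; exact hL.congr rfl rfl rfl, by simp,
      by simp [Store.setN_nreg]⟩
  · rintro s' hF ⟨hle, T, hQ, h1, h2⟩ hlt
    have hs' : HasInput A B c s' := (hs.congr (by rfl) (by rfl) (by rfl) (by rfl) (by rfl) (by rfl)
      (by rfl) (by rfl)).frame hF (by rfl)
    have h8 : s'.nreg 8 = x := (hF.nreg 8 (by rfl)).trans hx
    rw [hs'.size] at hlt
    obtain ⟨w, hw⟩ : ∃ w : Fin n, s'.nreg 9 = w := ⟨⟨_, hlt⟩, rfl⟩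
    have hsucc : ∀ u : Fin n, (u : ℕ) < w + 1 ↔ (u : ℕ) < w ∨ u = w := fun u => by
      rw [Fin.ext_iff]; omega
    rw [hw] at h2
    simp only [ok_seq, ok_instr, ok_ifLe, ok_skip, Instr.exec, Store.setN_nreg, Store.setN_narr,
      Store.setNArr_nreg, reduceIte, Nat.reduceEqDiff, hs'.zero, hs'.one, hw,
      h8, adj_iff hs', Nat.le_zero, hQ.mark]
    refine ⟨fun hadj => ⟨fun hmark => ?_, fun hmark => ?_⟩, fun hadj => ?_⟩
    · refine ⟨⟨by omega, T ++ [w], ?_, ?_, fun u hu hA => ?_⟩, by omega⟩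
      · rw [← List.append_assoc]
        refine hQ.push hmark one_ne_zero ?_ (fun p => ?_) fun p => ?_ <;>
          simp [Store.setN_nreg, Store.setN_narr, Store.setNArr_narr]
      · simpa [or_imp, forall_and, hadj] using h1
      · rw [← List.append_assoc]
        rcases (hsucc u).1 hu with h | rfl
        · exact List.mem_append_left _ (h2 u h hA)
        · simp
    · refine ⟨⟨by omega, T, hQ.congr rfl rfl rfl, h1, fun u hu hA => ?_⟩, by omega⟩
      rcases (hsucc u).1 hu with h | rfl
      · exact h2 u h hA
      · exact not_not.1 hmark
    · refine ⟨⟨by omega, T, hQ.congr rfl rfl rfl, h1, fun u hu hA => ?_⟩, by omega⟩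
      rcases (hsucc u).1 hu with h | rfl
      · exact h2 u h hA
      · exact absurd hA hadj
  · rintro t s' hF ⟨hle, T, hQ, h1, h2⟩ hlt ht
    have h0 : s'.nreg 0 = n := (hF.nreg 0 (by rfl)).trans hs.size
    refine ⟨?_, T, hQ, h1, fun w => h2 w (by omega)⟩
    simp only [Store.setN_nreg, reduceIte] at ht
    omega

theorem backwardScan_ok {s : Store} (hs : HasInput A B c s) (x : Fin n) (hx : s.nreg 8 = x)
    {R : List (Fin n)} (hR : Queue 6 7 7 R s) (hσ : s.nreg 13 ≠ 0) :
    Ok backwardScan s fun t s' => t ≤ 11 * n + 2 ∧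
      (s'.nreg 12 = 0 ↔ s.nreg 12 = 0 ∧ ∀ w : Fin n, A x w = true → s.narr 4 w 0 ≠ 0) ∧
      ∃ T, Queue 6 7 7 (R ++ T) s' ∧
        (∀ w ∈ T, A x w = true ∧ s.narr 4 w 0 ≠ 0 ∧ s'.narr 6 w 0 = s.nreg 13) ∧
        (∀ w : Fin n, w ∉ T → s'.narr 6 w 0 = s.narr 6 w 0) ∧
        ∀ w : Fin n, A x w = true → s.narr 4 w 0 ≠ 0 → w ∈ R ++ T := by
  unfold backwardScan
  simp only [ok_seq, ok_instr, Instr.exec]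
  refine ok_while
    (fun s' => s'.nreg 9 ≤ n ∧
      (s'.nreg 12 = 0 ↔ s.nreg 12 = 0 ∧
        ∀ w : Fin n, (w : ℕ) < s'.nreg 9 → A x w = true → s.narr 4 w 0 ≠ 0) ∧
      ∃ T, Queue 6 7 7 (R ++ T) s' ∧
        (∀ w ∈ T, A x w = true ∧ s.narr 4 w 0 ≠ 0 ∧ s'.narr 6 w 0 = s.nreg 13) ∧
        (∀ w : Fin n, w ∉ T → s'.narr 6 w 0 = s.narr 6 w 0) ∧
        ∀ w : Fin n, (w : ℕ) < s'.nreg 9 → A x w = true → s.narr 4 w 0 ≠ 0 → w ∈ R ++ T)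
    (fun s' => 11 * (n - s'.nreg 9)) ?_ ?_ ?_
  · exact ⟨by simp [Store.setN_nreg], by simp [Store.setN_nreg], [],
      by rw [List.append_nil]; exact hR.congr rfl rfl rfl, by simp, by simp [Store.setN_narr],
      by simp [Store.setN_nreg]⟩
  · rintro s' hF ⟨hle, hbad, T, hQ, h1, h2, h3⟩ hlt
    have hs' : HasInput A B c s' := (hs.congr (by rfl) (by rfl) (by rfl) (by rfl) (by rfl) (by rfl)
      (by rfl) (by rfl)).frame hF (by rfl)
    have h8 : s'.nreg 8 = x := (hF.nreg 8 (by rfl)).trans hx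
    have h13 : s'.nreg 13 = s.nreg 13 := hF.nreg 13 (by rfl)
    have h4 : s'.narr 4 = s.narr 4 := hF.narr 4 (by rfl)
    rw [hs'.size] at hlt
    obtain ⟨w, hw⟩ : ∃ w : Fin n, s'.nreg 9 = w := ⟨⟨_, hlt⟩, rfl⟩
    have hall : ∀ p : Fin n → Prop, (∀ u : Fin n, (u : ℕ) < w + 1 → p u) ↔
        (∀ u : Fin n, (u : ℕ) < w → p u) ∧ p w := fun p => by
      refine ⟨fun h => ⟨fun u hu => h u (by omega), h w (by omega)⟩, fun h u hu => ?_⟩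
      rcases (Nat.lt_succ_iff_lt_or_eq.1 hu) with hu | hu
      exacts [h.1 u hu, Fin.ext hu ▸ h.2]
    rw [hw] at h3 hbad
    simp only [ok_seq, ok_instr, ok_ifLe, ok_skip, Instr.exec, Store.setN_nreg, Store.setN_narr,
      Store.setNArr_nreg, reduceIte, Nat.reduceEqDiff, hs'.zero, hs'.one, hw,
      h8, h4, h13, adj_iff hs', Nat.le_zero, hQ.mark]
    refine ⟨fun hadj => ⟨fun hmark => ?_, fun hmark => ⟨fun hnew => ?_, fun hnew => ?_⟩⟩, fun hadj => ?_⟩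
    · exact ⟨⟨by omega, by rw [hall]; simp [hadj, hmark], T, hQ.congr rfl rfl rfl, h1, h2,
        (hall _).2 ⟨h3, fun _ h => absurd hmark h⟩⟩, by omega⟩
    · refine ⟨⟨by omega, by rw [hall, hbad]; simp [hmark], T ++ [w], ?_, fun u hu => ?_,
        fun u hu => ?_, (hall _).2 ⟨fun u hu hA hm => ?_, by simp⟩⟩, by omega⟩
      · rw [← List.append_assoc]
        refine hQ.push hnew hσ ?_ (fun p => ?_) fun p => ?_ <;>
          simp [Store.setN_nreg, Store.setN_narr, Store.setNArr_narr]
      · rcases List.mem_append.1 hu with hu | hu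
        · refine ⟨(h1 u hu).1, (h1 u hu).2.1, ?_⟩
          by_cases huw : (u : ℕ) = w
          · simp [Store.setNArr_narr, huw]
          · simp [Store.setNArr_narr, Store.setN_narr, huw, (h1 u hu).2.2]
        · obtain rfl := List.mem_singleton.1 hu
          exact ⟨hadj, hmark, by simp [Store.setNArr_narr]⟩
      · simp only [List.mem_append, List.mem_singleton, not_or] at hu
        simp [Store.setNArr_narr, Store.setN_narr, Fin.val_inj, hu.2, h2 u hu.1]
      · rw [← List.append_assoc]
        exact List.mem_append_left _ (h3 u hu hA hm)
    · exact ⟨⟨by omega, by rw [hall, hbad]; simp [hmark], T, hQ.congr rfl rfl rfl, h1, h2,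
        (hall _).2 ⟨h3, fun _ _ => not_not.1 hnew⟩⟩, by omega⟩
    · exact ⟨⟨by omega, by rw [hall, hbad]; simp [hadj], T, hQ.congr rfl rfl rfl, h1, h2,
        (hall _).2 ⟨h3, fun h => absurd h hadj⟩⟩, by omega⟩
  · rintro t s' hF ⟨hle, hbad, T, hQ, h1, h2, h3⟩ hlt ht
    have h0 : s'.nreg 0 = n := (hF.nreg 0 (by rfl)).trans hs.size
    have hlt' : ∀ w : Fin n, (w : ℕ) < s'.nreg 9 := fun w => by omega
    simp only [hlt', true_imp_iff] at hbad h3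
    refine ⟨?_, hbad, T, hQ, h1, h2, h3⟩
    simp only [Store.setN_nreg, reduceIte] at ht
    omega

end Loops

/-! ### The two searches and their amortized cost -/

section Search

variable {n q : ℕ} {A : Matrix (Fin n) (Fin n) Bool} {B : Matrix (Fin n) (Fin q) Bool}
  {c : Fin q → ℝ}

theorem Queue.head {m a r : ℕ} {P T : List (Fin n)} {s : Store} (h : Queue m a r (P ++ T) s)
    (hlt : P.length < s.nreg r) :
    ∃ x T', T = x :: T' ∧ s.narr a P.length 0 = x := by
  rw [h.length] at hlt
  have hget := h.get _ hlt
  cases T with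
  | nil => simp at hlt
  | cons x T' => exact ⟨x, T', rfl, by simpa using hget⟩

/-- `L` is what earlier searches marked; being closed under successors, it is never expanded again.
The time bound compares potentials before and after, so that it telescopes over the candidates. -/
theorem forwardSearch_ok {s : Store} (hs : HasInput A B c s) (v : Fin n) (hv : s.nreg 3 = v)
    {L : List (Fin n)} (hL : Queue 4 5 5 L s) (hhead : s.nreg 4 = L.length) (hvL : v ∉ L)
    (hcl : ∀ x ∈ L, ∀ w, A w x = true → w ∈ L) :
    Ok forwardSearch s fun t s' => ∃ L', Queue 4 5 5 L' s' ∧ s'.nreg 4 = L'.length ∧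
      (∀ w ∈ L, w ∈ L') ∧ v ∈ L' ∧ (∀ x ∈ L', ∀ w, A w x = true → w ∈ L') ∧
      (∀ w ∈ L', w ∈ L ∨ Reach (stateDigraph A) v w) ∧
      t + (9 * n + 5) * (n - L'.length) ≤ (9 * n + 5) * (n - L.length) + 4 := by
  unfold forwardSearch
  simp only [ok_seq, ok_instr, Instr.exec]
  refine ok_while
    -- `P` is the expanded part of the queue, `T` the waiting part.
    (fun s' => ∃ P T, s'.nreg 4 = P.length ∧ Queue 4 5 5 (P ++ T) s' ∧ (∀ w ∈ L, w ∈ P ++ T) ∧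
      v ∈ P ++ T ∧ (∀ x ∈ P, ∀ w, A w x = true → w ∈ P ++ T) ∧
      ∀ w ∈ P ++ T, w ∈ L ∨ Reach (stateDigraph A) v w)
    (fun s' => (9 * n + 5) * (n - s'.nreg 4)) ?_ ?_ ?_
  · refine ⟨L, [v], hhead, ?_, fun w => List.mem_append_left _, by simp,
      fun x hx w hw => List.mem_append_left _ (hcl x hx w hw), fun w hw => ?_⟩
    · refine hL.push hvL one_ne_zero ?_ (fun p => ?_) fun p => ?_ <;>
        simp [Store.setN_nreg, Store.setN_narr, Store.setNArr_narr, Store.setNArr_nreg, hs.zero,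
          hs.one, hv]
    · rcases List.mem_append.1 hw with h | h
      · exact .inl h
      · exact .inr (List.mem_singleton.1 h ▸ .refl)
  · rintro s' hF ⟨P, T, hP, hQ, h1, h2, h3, h4⟩ hlt
    have hs' : HasInput A B c s' := (hs.congr (by rfl) (by rfl) (by rfl) (by rfl) (by rfl) (by rfl)
      (by rfl) (by rfl)).frame hF (by rfl)
    have hle := hQ.length_le
    rw [hP] at hlt
    obtain ⟨x, T, rfl, hx⟩ := hQ.head hlt
    simp only [ok_seq, ok_instr, Instr.exec]
    refine Ok.mono (forwardScan_ok (hs'.congr ?_ ?_ ?_ ?_ ?_ ?_ ?_ ?_) x ?_ (hQ.congr ?_ ?_ ?_)) ?_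
    iterate 8 rfl
    rotate_left
    iterate 3 rfl
    rotate_left
    · simp [Store.setN_nreg, hP, hs'.zero, hx]
    · rintro t s'' hF' ⟨ht, U, hU, hU1, hU2⟩
      have hnreg : s''.nreg 4 = P.length + 1 := by
        rw [hF'.nreg 4 (by rfl)]; simp [Store.setN_nreg, hP]
      refine ⟨⟨P ++ [x], T ++ U, by simp [hnreg], by simpa using hU, ?_, ?_, ?_, ?_⟩, ?_⟩
      · intro w hw
        have := h1 w hw
        simp only [List.mem_append, List.mem_cons] at this ⊢
        tauto
      · simp only [List.mem_append, List.mem_cons] at h2 ⊢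
        tauto
      · intro y hy w hw
        rcases List.mem_append.1 hy with hy | hy
        · have := h3 y hy w hw
          simp only [List.mem_append, List.mem_cons] at this ⊢
          tauto
        · obtain rfl := List.mem_singleton.1 hy
          have := hU2 w hw
          simp only [List.mem_append, List.mem_cons] at this ⊢
          tauto
      · intro w hw
        by_cases hwU : w ∈ U
        · have hadj : (stateDigraph A).Adj x w := hU1 w hwU
          rcases h4 x (by simp) with h | h
          · exact .inl (hcl x h w hadj)
          · exact .inr (h.tail hadj)
        · refine h4 w ?_
          simp only [List.mem_append, List.mem_cons] at hw ⊢
          tauto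
      · simp only [List.length_append, List.length_cons] at hle
        obtain ⟨d, hd⟩ : ∃ d, n - P.length = d + 1 := ⟨n - P.length - 1, by omega⟩
        rw [hnreg, hP, hd, show n - (P.length + 1) = d by omega, Nat.mul_succ]
        omega
  · rintro t s' hF ⟨P, T, hP, hQ, h1, h2, h3, h4⟩ hlt ht
    rw [hQ.length, hP] at hlt
    obtain rfl : T = [] := by simpa using hlt
    rw [List.append_nil] at *
    refine ⟨P, hQ, hP, h1, h2, h3, h4, ?_⟩
    simp only [Store.setN_nreg, Store.setNArr_nreg, Nat.reduceEqDiff, reduceIte, hP, hhead] at ht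
    omega

/-- The potential of the backward search: a bound for the time that the vertices outside `R` take. -/
def backwardPotential (B : Matrix (Fin n) (Fin q) Bool) (R : List (Fin n)) : ℕ :=
  -- One expansion: `11 * n + 2` for the scan, `8 * length + 3` for the cost loop, two instructions
  -- and the loop test.
  ∑ i with i ∉ R, (11 * n + 8 * (inputsOf B i).length + 8)

theorem backwardPotential_push {R : List (Fin n)} {x : Fin n} (hx : x ∉ R) :
    backwardPotential B (R ++ [x]) + (11 * n + 8 * (inputsOf B x).length + 8) =
      backwardPotential B R := by
  unfold backwardPotential
  rw [add_comm, ← Finset.sum_insert (s := {i | i ∉ R ++ [x]})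
    (f := fun i => 11 * n + 8 * (inputsOf B i).length + 8) (by simp)]
  congr 1
  ext i
  by_cases hi : i = x <;> simp [hi, hx]

/-- All earlier stamps are at most `v`, so the stamp `v + 1` is fresh and the input stamps need no
clearing between candidates. -/
theorem backwardSearch_ok {s : Store} (hs : HasInput A B c s) (v : Fin n) (hv : s.nreg 3 = v)
    {R : List (Fin n)} (hR : Queue 6 7 7 R s) (hhead : s.nreg 6 = R.length) (hvR : v ∉ R)
    (hvL : s.narr 4 v 0 ≠ 0) (hstamp : ∀ j : Fin q, s.narr 8 j 0 ≤ v) :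
    Ok backwardSearch s fun t s' => ∃ S, Queue 6 7 7 (R ++ S) s' ∧ s'.nreg 6 = (R ++ S).length ∧
      v ∈ S ∧
      (∀ w ∈ S, Reach (stateDigraph A) w v ∧ s.narr 4 w 0 ≠ 0 ∧ s'.narr 6 w 0 = v + 1) ∧
      (∀ w : Fin n, w ∉ S → s'.narr 6 w 0 = s.narr 6 w 0) ∧
      (∀ x ∈ S, ∀ w : Fin n, A x w = true → s.narr 4 w 0 ≠ 0 → w ∈ R ++ S) ∧
      (s'.nreg 12 = 0 ↔ ∀ x ∈ S, ∀ w : Fin n, A x w = true → s.narr 4 w 0 ≠ 0) ∧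
      s'.nreg 13 = v + 1 ∧ (∀ j : Fin q, s'.narr 8 j 0 ≤ v + 1) ∧
      s'.rreg 1 = adjacentInputCost A B c {w | w ∈ S} ∧
      t + backwardPotential B (R ++ S) ≤ backwardPotential B R + 8 := by
  classical
  unfold backwardSearch
  simp only [ok_seq, ok_instr, Instr.exec]
  -- `D` is the expanded part of this search and `T` the waiting part. The potential depends on the
  -- list `D`, which is bound inside the invariant, hence the rule with an explicit potential.
  refine ok_while_potential (m := backwardPotential B R)
    (fun m s' => ∃ D T, s'.nreg 6 = (R ++ D).length ∧ Queue 6 7 7 (R ++ D ++ T) s' ∧ v ∈ D ++ T ∧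
      (∀ w ∈ D ++ T, Reach (stateDigraph A) w v ∧ s.narr 4 w 0 ≠ 0 ∧ s'.narr 6 w 0 = v + 1) ∧
      (∀ w : Fin n, w ∉ D ++ T → s'.narr 6 w 0 = s.narr 6 w 0) ∧
      (∀ x ∈ D, ∀ w : Fin n, A x w = true → s.narr 4 w 0 ≠ 0 → w ∈ R ++ D ++ T) ∧
      (s'.nreg 12 = 0 ↔ ∀ x ∈ D, ∀ w : Fin n, A x w = true → s.narr 4 w 0 ≠ 0) ∧
      (∀ j : Fin q, s'.narr 8 j 0 ≤ v + 1) ∧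
      (∀ j : Fin q, s'.narr 8 j 0 = v + 1 ↔ ∃ x ∈ D, B x j = true) ∧
      s'.rreg 1 = stampedCost c (v + 1) s' ∧ m = backwardPotential B (R ++ D)) ?_ ?_ ?_
  · refine ⟨[], [v], by rw [List.append_nil]; exact hhead, ?_, by simp, fun w hw => ?_,
      fun w hw => ?_, by simp, by simp [Store.setN_nreg, Store.setNArr_nreg, Store.setR_nreg],
      fun j => ?_, fun j => ?_, ?_, by simp⟩
    · rw [List.append_nil]
      refine hR.push hvR (Nat.succ_ne_zero v) ?_ (fun p => ?_) fun p => ?_ <;>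
        simp [Store.setN_nreg, Store.setN_narr, Store.setNArr_narr, Store.setNArr_nreg,
          Store.setR_nreg, Store.setR_narr, hs.zero, hv]
    · obtain rfl : w = v := by simpa using hw
      exact ⟨.refl, hvL, by simp [Store.setN_nreg, Store.setN_narr, Store.setNArr_narr,
        Store.setNArr_nreg, Store.setR_nreg, hs.zero, hv]⟩
    · have hwv : (w : ℕ) ≠ v := fun h => hw (by simp [Fin.ext h])
      simp [Store.setN_nreg, Store.setN_narr, Store.setNArr_narr,
        Store.setNArr_nreg, Store.setR_nreg, Store.setR_narr, hs.zero, hv, hwv]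
    · exact (hstamp j).trans (Nat.le_succ _)
    · have := hstamp j
      exact iff_of_false (ne_of_lt (Nat.lt_succ_of_le this)) (by simp)
    · rw [stampedCost, Finset.filter_false_of_mem, Finset.sum_empty]
      · exact hs.rzero
      · exact fun j _ => ne_of_lt (Nat.lt_succ_of_le (hstamp j))
  · rintro m s' hF ⟨D, T, hD, hQ, h1, h2, h3, h4, h5, h6, h7, h8, rfl⟩ hlt
    have hs' : HasInput A B c s' := (hs.congr (by rfl) (by rfl) (by rfl) (by rfl) (by rfl) (by rfl)
      (by rfl) (by rfl)).frame hF (by rfl)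
    have h13 : s'.nreg 13 = v + 1 := by
      rw [hF.nreg 13 (by rfl)]
      simp [Store.setN_nreg, Store.setNArr_nreg, Store.setR_nreg, hv]
    have hm4 : s'.narr 4 = s.narr 4 := hF.narr 4 (by rfl)
    rw [hD] at hlt
    obtain ⟨x, T, rfl, hx⟩ := hQ.head hlt
    have hxD : x ∉ R ++ D := fun h =>
      List.disjoint_of_nodup_append hQ.nodup h (by simp)
    simp only [ok_seq, ok_instr, Instr.exec]
    refine Ok.mono (backwardScan_ok (hs'.congr ?_ ?_ ?_ ?_ ?_ ?_ ?_ ?_) x ?_ (hQ.congr ?_ ?_ ?_) ?_)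
      ?_
    iterate 8 rfl
    rotate_left
    iterate 3 rfl
    rotate_right
    · simp [Store.setN_nreg, hD, hs'.zero, ← hx]
    · simp [Store.setN_nreg, h13]
    rintro t s₁ hF₁ ⟨ht, hbad, U, hU, hU1, hU2, hU3⟩
    have hs₁ : HasInput A B c s₁ := (hs'.congr (by rfl) (by rfl) (by rfl) (by rfl) (by rfl)
      (by rfl) (by rfl) (by rfl)).frame hF₁ (by rfl)
    have h13' : s₁.nreg 13 = v + 1 := (hF₁.nreg 13 (by rfl)).trans h13
    have hm8 : s₁.narr 8 = s'.narr 8 := hF₁.narr 8 (by rfl)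
    simp only [Store.setN_nreg, Store.setN_narr, Nat.reduceEqDiff, reduceIte, hm4, h13] at hbad hU1 hU2 hU3
    refine (costLoop_ok hs₁ x ?_ ?_ ?_).mono ?_
    · rw [hF₁.nreg 8 (by rfl)]
      simp [Store.setN_nreg, hD, hs'.zero, ← hx]
    · rw [hm8, h13']; exact h6
    · rw [hF₁.rreg 1 (by rfl), h13', stampedCost, hm8]; exact h8
    rintro t' s₂ hF₂ ⟨hc1, hc2, hc3, ht'⟩
    rw [h13'] at hc1 hc2 hc3
    have hm6 : s₂.narr 6 = s₁.narr 6 := hF₂.narr 6 (by rfl)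
    have hnreg : s₂.nreg 6 = (R ++ D).length + 1 := by
      rw [hF₂.nreg 6 (by rfl), hF₁.nreg 6 (by rfl)]; simp [Store.setN_nreg, hD]
    refine ⟨_, ⟨D ++ [x], T ++ U, by rw [hnreg]; simp; omega, ?_, ?_, fun w hw => ?_,
      fun w hw => ?_, fun y hy w hA hw => ?_, ?_, hc1, fun j => ?_, hc3, rfl⟩, ?_⟩
    · have := hU.congr (s' := s₂) (hF₂.nreg 7 (by rfl)) (hF₂.narr 7 (by rfl)) hm6
      simpa using this
    · simp only [List.mem_append, List.mem_cons] at h1 ⊢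
      tauto
    · rw [hm6]
      by_cases hwU : w ∈ U
      · exact ⟨.head (hU1 w hwU).1 (h2 x (by simp)).1, (hU1 w hwU).2⟩
      · rw [hU2 w hwU]
        refine h2 w ?_
        simp only [List.mem_append, List.mem_cons] at hw ⊢
        tauto
    · have hw' : w ∉ U ∧ w ∉ D ++ x :: T := by
        simp only [List.mem_append, List.mem_cons] at hw ⊢
        tauto
      rw [hm6, hU2 w hw'.1, h3 w hw'.2]
    · have : w ∈ R ++ D ++ x :: T ++ U := by
        rcases List.mem_append.1 hy with hy | hy
        · exact List.mem_append_left _ (h4 y hy w hA hw)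
        · obtain rfl := List.mem_singleton.1 hy
          exact hU3 w hA hw
      simp only [List.mem_append, List.mem_cons] at this ⊢
      tauto
    · rw [hF₂.nreg 12 (by rfl), hbad, h5]
      simp only [List.mem_append, List.mem_singleton, or_imp, forall_and, forall_eq]
    · rw [hc2, hm8, h7]
      simp only [List.mem_append, List.mem_singleton, or_and_right, exists_or, exists_eq_left]
    · have := backwardPotential_push (B := B) hxD
      rw [← List.append_assoc]
      omega
  · rintro t m s' hF ⟨D, T, hD, hQ, h1, h2, h3, h4, h5, h6, h7, h8, rfl⟩ hlt ht
    have h13 : s'.nreg 13 = v + 1 := by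
      rw [hF.nreg 13 (by rfl)]
      simp [Store.setN_nreg, Store.setNArr_nreg, Store.setR_nreg, hv]
    rw [hQ.length, hD] at hlt
    obtain rfl : T = [] := by simpa using hlt
    rw [List.append_nil] at *
    refine ⟨D, hQ, hD, h1, h2, h3, h4, h5, h13, h6, ?_, by omega⟩
    rw [h8, stampedCost, adjacentInputCost_eq]
    simp only [h7, Set.mem_ofPred_eq]

end Search

/-! ### The loop over the candidates -/

section Main

variable {n q : ℕ} {A : Matrix (Fin n) (Fin n) Bool} {B : Matrix (Fin n) (Fin q) Bool}
  {c : Fin q → ℝ}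

/-- Among the source SCCs with a vertex below `k`, the vertices marked with `b` form one of minimal
cost `r`; if there is no such component, then `b = 0`. -/
def IsBest (A : Matrix (Fin n) (Fin n) Bool) (B : Matrix (Fin n) (Fin q) Bool) (c : Fin q → ℝ)
    (k : ℕ) (μ : Fin n → ℕ) (b : ℕ) (r : ℝ) : Prop :=
  (b = 0 → ∀ N, IsSourceSCC (stateDigraph A) N → ∀ u ∈ N, ¬ (u : ℕ) < k) ∧
    (b ≠ 0 → b ≤ k ∧ IsSourceSCC (stateDigraph A) {w | μ w = b} ∧
      r = adjacentInputCost A B c {w | μ w = b} ∧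
      ∀ N, IsSourceSCC (stateDigraph A) N → ∀ u ∈ N, (u : ℕ) < k → r ≤ adjacentInputCost A B c N)

/-- For keeping the current best component: a source SCC that newly comes into range was already in
range through another vertex, or is not cheaper. -/
theorem IsBest.of_forall {k k' : ℕ} {μ μ' : Fin n → ℕ} {b : ℕ} {r : ℝ} (h : IsBest A B c k μ b r)
    (hk : k ≤ k') (hμ : b ≠ 0 → ∀ w, μ' w = b ↔ μ w = b)
    (hnew : ∀ N, IsSourceSCC (stateDigraph A) N → ∀ u ∈ N, (u : ℕ) < k' →
      (∃ u' ∈ N, (u' : ℕ) < k) ∨ (b ≠ 0 ∧ r ≤ adjacentInputCost A B c N)) :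
    IsBest A B c k' μ' b r := by
  refine ⟨fun hb N hN u hu huk => ?_, fun hb => ?_⟩
  · rcases hnew N hN u hu huk with ⟨u', hu', hlt⟩ | h'
    exacts [h.1 hb N hN u' hu' hlt, h'.1 hb]
  · obtain ⟨h1, h2, h3, h4⟩ := h.2 hb
    simp only [hμ hb]
    refine ⟨h1.trans hk, h2, h3, fun N hN u hu huk => ?_⟩
    rcases hnew N hN u hu huk with ⟨u', hu', hlt⟩ | h'
    exacts [h4 N hN u' hu' hlt, h'.2]

/-- The invariant of the loop over the candidates, with the lists of the vertices that carry marks of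
the forward and of the backward search. -/
structure CandidateInv (A : Matrix (Fin n) (Fin n) Bool) (B : Matrix (Fin n) (Fin q) Bool)
    (c : Fin q → ℝ) (L R : List (Fin n)) (s : Store) : Prop where
  input : HasInput A B c s
  le : s.nreg 3 ≤ n
  forward : Queue 4 5 5 L s
  forwardHead : s.nreg 4 = L.length
  backward : Queue 6 7 7 R s
  backwardHead : s.nreg 6 = R.length
  subset : ∀ w ∈ R, w ∈ L
  mem_iff : ∀ w, w ∈ L ↔ ∃ u : Fin n, (u : ℕ) < s.nreg 3 ∧ Reach (stateDigraph A) u w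
  stamp : ∀ j : Fin q, s.narr 8 j 0 ≤ s.nreg 3
  mark : ∀ w : Fin n, s.narr 6 w 0 ≤ s.nreg 3
  best : IsBest A B c (s.nreg 3) (fun w => s.narr 6 w 0) (s.nreg 14) (s.rreg 0)

/-- The potential of the loop over the candidates. -/
def candidatePotential (B : Matrix (Fin n) (Fin q) Bool) (L R : List (Fin n)) (k : ℕ) : ℕ :=
  -- The `25` covers the fixed work per candidate: the start-up of both searches, the tests, the
  -- update, the increment and the loop test.
  (9 * n + 5) * (n - L.length) + backwardPotential B R + 25 * (n - k)

theorem CandidateInv.closed {L R : List (Fin n)} {s : Store} (h : CandidateInv A B c L R s)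
    {x w : Fin n} (hx : x ∈ L) (hxw : Reach (stateDigraph A) x w) : w ∈ L := by
  obtain ⟨u, hu, hux⟩ := (h.mem_iff x).1 hx
  exact (h.mem_iff w).2 ⟨u, hu, hux.trans hxw⟩

theorem lt_succ_iff_lt_or_eq {v : Fin n} (u : Fin n) :
    (u : ℕ) < v + 1 ↔ (u : ℕ) < v ∨ u = v := by
  rw [Fin.ext_iff]; omega

theorem mem_iff_of_forwardSearch {L R L' : List (Fin n)} {s : Store}
    (h : CandidateInv A B c L R s) {v : Fin n} (hv : s.nreg 3 = v)
    (h1 : ∀ w ∈ L, w ∈ L') (h2 : v ∈ L') (h3 : ∀ x ∈ L', ∀ w, A w x = true → w ∈ L')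
    (h4 : ∀ w ∈ L', w ∈ L ∨ Reach (stateDigraph A) v w) (w : Fin n) :
    w ∈ L' ↔ ∃ u : Fin n, (u : ℕ) < v + 1 ∧ Reach (stateDigraph A) u w := by
  constructor
  · intro hw
    rcases h4 w hw with hw | hw
    · obtain ⟨u, hu, huw⟩ := (h.mem_iff w).1 hw
      exact ⟨u, by omega, huw⟩
    · exact ⟨v, by omega, hw⟩
  · rintro ⟨u, hu, huw⟩
    rcases (lt_succ_iff_lt_or_eq u).1 hu with hu | rfl
    · exact h1 w ((h.mem_iff w).2 ⟨u, hv ▸ hu, huw⟩)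
    · clear hu
      induction huw with
      | refl => exact h2
      | tail _ hbc ih => exact h3 _ ih _ hbc

/-- If the backward search meets forward marks only, then it finds a source SCC. -/
theorem backwardSearch_isSourceSCC {L R L' S : List (Fin n)} {s : Store}
    (h : CandidateInv A B c L R s) {v : Fin n} (hvL : v ∉ L)
    (h4 : ∀ w ∈ L', w ∈ L ∨ Reach (stateDigraph A) v w) (hvS : v ∈ S)
    (hS : ∀ w ∈ S, Reach (stateDigraph A) w v)
    (hcl : ∀ x ∈ S, ∀ w : Fin n, A x w = true → w ∈ L' → w ∈ R ++ S)
    (hgood : ∀ x ∈ S, ∀ w : Fin n, A x w = true → w ∈ L')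
    (hSL : ∀ w ∈ S, w ∈ L') :
    IsSourceSCC (stateDigraph A) {w | w ∈ S} := by
  have hclosed : ∀ x ∈ {w | w ∈ S}, ∀ w, (stateDigraph A).Adj w x → w ∈ {w | w ∈ S} := by
    intro x hx w hw
    rcases List.mem_append.1 (hcl x hx w hw (hgood x hx w hw)) with hR | hwS
    -- A vertex of an earlier backward search carries a forward mark, and since it reaches `v`, so
    -- would `v`.
    · exact absurd (h.closed (h.subset w hR) (.head hw (hS x hx))) hvL
    · exact hwS
  have heq : {w | w ∈ S} = {w | Reach (stateDigraph A) w v} :=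
    Set.ext fun w => ⟨fun hw => hS w hw, fun hw => (reach_within_of_closed hclosed hw hvS).1⟩
  rw [heq]
  refine isSourceSCC_ancestors fun w hw => ?_
  have hwS : w ∈ {w | w ∈ S} := heq ▸ hw
  rcases h4 w (hSL w hwS) with hwL | hwv
  · exact absurd (h.closed hwL hw) hvL
  · exact hwv

/-- If `v` already carries a forward mark, some earlier vertex reaches it and lies in every source
SCC containing `v`, so nothing new comes into range. Otherwise the flag decides whether the
component just found is a source SCC that competes with the best one. -/
theorem candidateStep_ok {s : Store} {L R : List (Fin n)} (h : CandidateInv A B c L R s)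
    (hlt : s.nreg 3 < n) :
    Ok candidateStep s fun t s' => ∃ L' R', CandidateInv A B c L' R' s' ∧
      t + 1 + candidatePotential B L' R' (s'.nreg 3) ≤ candidatePotential B L R (s.nreg 3) := by
  obtain ⟨v, hv⟩ : ∃ v : Fin n, s.nreg 3 = v := ⟨⟨_, hlt⟩, rfl⟩
  unfold candidateStep candidatePotential
  simp only [ok_seq, ok_instr, ok_ifLe, ok_skip, Instr.exec, Store.setN_nreg,
    reduceIte, Nat.reduceEqDiff, h.input.zero, hv, Nat.le_zero, h.forward.mark]
  refine ⟨fun hvL => ?_, fun hvL => ?_⟩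
  · have hvR : v ∉ R := fun hR => hvL (h.subset v hR)
    refine Ok.mono (forwardSearch_ok (h.input.congr ?_ ?_ ?_ ?_ ?_ ?_ ?_ ?_) v ?_
      (h.forward.congr ?_ ?_ ?_) ?_ hvL fun x hx w hw => h.closed hx (.single hw)) ?_
    iterate 8 rfl
    · exact hv
    iterate 3 rfl
    · exact h.forwardHead
    rintro t₁ s₁ hF₁ ⟨L', hL', hh', h1, h2, h3, h4, ht₁⟩
    have hs₁ : HasInput A B c s₁ := (h.input.congr (by rfl) (by rfl) (by rfl) (by rfl) (by rfl)
      (by rfl) (by rfl) (by rfl)).frame hF₁ (by rfl)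
    have hmem := mem_iff_of_forwardSearch h hv h1 h2 h3 h4
    have hL'mark : ∀ w : Fin n, s₁.narr 4 w 0 ≠ 0 ↔ w ∈ L' := fun w => by
      rw [Ne, hL'.mark, not_not]
    refine Ok.mono (backwardSearch_ok hs₁ v ((hF₁.nreg 3 (by rfl)).trans hv)
      (h.backward.congr (hF₁.nreg 7 (by rfl)) (hF₁.narr 7 (by rfl)) (hF₁.narr 6 (by rfl)))
      ((hF₁.nreg 6 (by rfl)).trans h.backwardHead) hvR ((hL'mark v).2 h2) fun j => ?_) ?_
    · rw [hF₁.narr 8 (by rfl), ← hv]; exact h.stamp j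
    rintro t₂ s₂ hF₂ ⟨S, hS, hhS, hvS, hS1, hS2, hcl, hbad, h13, hstamp, hcost, ht₂⟩
    have hs₂ : HasInput A B c s₂ := hs₁.frame hF₂ (by rfl)
    simp only [hL'mark] at hS1 hcl hbad
    have hm6 : s₁.narr 6 = s.narr 6 := hF₁.narr 6 (by rfl)
    have h14 : s₂.nreg 14 = s.nreg 14 := (hF₂.nreg 14 (by rfl)).trans (hF₁.nreg 14 (by rfl))
    have hr0 : s₂.rreg 0 = s.rreg 0 := (hF₂.rreg 0 (by rfl)).trans (hF₁.rreg 0 (by rfl))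
    have h3' : s₂.nreg 3 = v := ((hF₂.nreg 3 (by rfl)).trans (hF₁.nreg 3 (by rfl))).trans hv
    have hbest := h.best
    rw [hv] at hbest
    have hmark : ∀ w : Fin n, s.narr 6 w 0 ≤ v := fun w => hv ▸ h.mark w
    have hset : {w : Fin n | s₂.narr 6 w 0 = v + 1} = {w | w ∈ S} := by
      ext w
      refine ⟨fun hw => by_contra fun hwS => ?_, fun hw => (hS1 w hw).2.2⟩
      have hw' : s₂.narr 6 w 0 = v + 1 := hw
      rw [hS2 w hwS, hm6] at hw'
      have := hmark w
      omega
    -- The new search only stamps vertices that had no backward mark, so the best component stays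
    -- readable from array `6`.
    have hold : s.nreg 14 ≠ 0 → ∀ w : Fin n, s₂.narr 6 w 0 = s.nreg 14 ↔ s.narr 6 w 0 = s.nreg 14 := by
      intro h0 w
      have hle := (hbest.2 h0).1
      by_cases hwS : w ∈ S
      · have hwR : w ∉ R := fun hR => List.disjoint_of_nodup_append hS.nodup hR hwS
        rw [(hS1 w hwS).2.2, (h.backward.mark w).2 hwR]
        omega
      · rw [hS2 w hwS, hm6]
    have finish : ∀ (b : ℕ) (r : ℝ), IsBest A B c (v + 1) (fun w => s₂.narr 6 w 0) b r →
        ∀ s₃ : Store, HasInput A B c s₃ → s₃.nreg 3 = v + 1 → s₃.nreg 4 = s₂.nreg 4 →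
          s₃.nreg 5 = s₂.nreg 5 → s₃.nreg 6 = s₂.nreg 6 → s₃.nreg 7 = s₂.nreg 7 →
          s₃.narr = s₂.narr → s₃.nreg 14 = b → s₃.rreg 0 = r → CandidateInv A B c L' (R ++ S) s₃ := by
      rintro b r hb s₃ hs₃ e3 e4 e5 e6 e7 ea e14 er
      refine ⟨hs₃, by omega, ?_, ?_, hS.congr e7 (by rw [ea]) (by rw [ea]), e6.trans hhS, ?_, ?_, ?_,
        ?_, ?_⟩
      · exact hL'.congr (e5.trans (hF₂.nreg 5 (by rfl))) (by rw [ea, hF₂.narr 5 (by rfl)])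
          (by rw [ea, hF₂.narr 4 (by rfl)])
      · rw [e4, hF₂.nreg 4 (by rfl), hh']
      · intro w hw
        rcases List.mem_append.1 hw with hw | hw
        exacts [h1 w (h.subset w hw), (hS1 w hw).2.1]
      · rw [e3]; exact hmem
      · rw [e3, ea]; exact hstamp
      · rw [e3, ea]
        intro w
        by_cases hwS : w ∈ S
        · exact (hS1 w hwS).2.2.le
        · rw [hS2 w hwS, hm6]; exact (hmark w).trans (Nat.le_succ _)
      · rw [e3, ea, e14, er]; exact hb
    have hsrc : s₂.nreg 12 = 0 → IsSourceSCC (stateDigraph A) {w | w ∈ S} := fun h0 =>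
      backwardSearch_isSourceSCC h hvL h4 hvS (fun w hw => (hS1 w hw).1) hcl (hbad.1 h0)
        fun w hw => (hS1 w hw).2.1
    have hnewN : s₂.nreg 12 = 0 → ∀ N, IsSourceSCC (stateDigraph A) N → v ∈ N → N = {w | w ∈ S} :=
      fun h0 N hN hvN => (hN.eq_ancestors hvN).trans ((hsrc h0).eq_ancestors hvS).symm
    -- If a source SCC contained `v`, it would contain every predecessor met, and `v` would reach
    -- them all; the flag would not be raised.
    have hnone : s₂.nreg 12 ≠ 0 → ∀ N, IsSourceSCC (stateDigraph A) N → v ∉ N := by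
      intro h0 N hN hvN
      refine h0 (hbad.2 fun x hx w hw => ?_)
      have hwN : w ∈ N := by
        rw [hN.eq_ancestors hvN]; exact .head hw (hS1 x hx).1
      exact (hmem w).2 ⟨v, by omega, hN.reach hvN hwN⟩
    have hupd : s₂.nreg 12 = 0 → (s.nreg 14 ≠ 0 → s₂.rreg 1 ≤ s.rreg 0) →
        IsBest A B c (v + 1) (fun w => s₂.narr 6 w 0) (v + 1) (s₂.rreg 1) := by
      intro h0 hle
      refine ⟨fun h => absurd h (Nat.succ_ne_zero _), fun _ => ?_⟩
      rw [hset]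
      refine ⟨le_rfl, hsrc h0, hcost, fun N hN u hu huv => ?_⟩
      rcases (lt_succ_iff_lt_or_eq u).1 huv with huv | rfl
      · by_cases hb : s.nreg 14 = 0
        · exact absurd huv (hbest.1 hb N hN u hu)
        · exact (hle hb).trans ((hbest.2 hb).2.2.2 N hN u hu huv)
      · rw [hcost, hnewN h0 N hN hu]
    have hkeep : (s₂.nreg 12 = 0 → s.nreg 14 ≠ 0 ∧ s.rreg 0 ≤ s₂.rreg 1) →
        IsBest A B c (v + 1) (fun w => s₂.narr 6 w 0) (s.nreg 14) (s.rreg 0) := by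
      intro hle
      refine hbest.of_forall (Nat.le_succ _) hold fun N hN u hu huv => ?_
      rcases (lt_succ_iff_lt_or_eq u).1 huv with huv | rfl
      · exact .inl ⟨u, hu, huv⟩
      · right
        by_cases h0 : s₂.nreg 12 = 0
        · rw [hnewN h0 N hN hu, ← hcost]; exact hle h0
        · exact absurd hu (hnone h0 N hN)
    obtain ⟨d, hd⟩ : ∃ d, n - (v : ℕ) = d + 1 := ⟨n - v - 1, by omega⟩
    have hd' : n - ((v : ℕ) + 1) = d := by omega
    simp only [updateBest, ok_seq, ok_instr, ok_ifRLe, ok_skip, Instr.exec, Store.setN_nreg,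
      Store.setN_rreg, Store.setR_nreg,
      reduceIte, Nat.reduceEqDiff, hs₂.zero, Nat.le_zero, h3', h14, hr0, hd, hd']
    refine ⟨fun h0 => ⟨fun hb => ?_, fun hb => ⟨fun hle => ?_, fun hle => ?_⟩⟩, fun h0 => ?_⟩
    · refine ⟨L', R ++ S, finish _ _ (hupd h0 fun h => absurd hb h) _
        (hs₂.congr ?_ ?_ ?_ ?_ ?_ ?_ ?_ ?_) ?_ ?_ ?_ ?_ ?_ ?_ ?_ ?_,
        by omega⟩
      all_goals first | rfl | exact h13
    · refine ⟨L', R ++ S, finish _ _ (hupd h0 fun _ => hle) _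
        (hs₂.congr ?_ ?_ ?_ ?_ ?_ ?_ ?_ ?_) ?_ ?_ ?_ ?_ ?_ ?_ ?_ ?_,
        by omega⟩
      all_goals first | rfl | exact h13
    · refine ⟨L', R ++ S, finish _ _ (hkeep fun _ => ⟨hb, (not_le.1 hle).le⟩) _
        (hs₂.congr ?_ ?_ ?_ ?_ ?_ ?_ ?_ ?_) ?_ ?_ ?_ ?_ ?_ ?_ ?_ ?_,
        by omega⟩
      all_goals first | rfl | exact h14 | exact hr0
    · refine ⟨L', R ++ S, finish _ _ (hkeep fun h => absurd h h0) _
        (hs₂.congr ?_ ?_ ?_ ?_ ?_ ?_ ?_ ?_) ?_ ?_ ?_ ?_ ?_ ?_ ?_ ?_,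
        by omega⟩
      all_goals first | rfl | exact h14 | exact hr0
  · rw [not_not] at hvL
    have hmem : ∀ w, w ∈ L ↔ ∃ u : Fin n, (u : ℕ) < v + 1 ∧ Reach (stateDigraph A) u w := fun w =>
      mem_iff_of_forwardSearch h hv (fun _ => id) hvL
        (fun x hx w hw => h.closed hx (.single hw)) (fun _ => .inl) w
    refine ⟨L, R, ⟨h.input.congr ?_ ?_ ?_ ?_ ?_ ?_ ?_ ?_, ?_, h.forward.congr ?_ ?_ ?_,
      h.forwardHead, h.backward.congr ?_ ?_ ?_, h.backwardHead, h.subset, ?_, fun j => ?_, fun w => ?_, ?_⟩,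
      by omega⟩
    iterate 8 rfl
    · exact v.2
    iterate 6 rfl
    · simpa [Store.setN_nreg] using hmem
    · exact (hv ▸ h.stamp j).trans (Nat.le_succ _)
    · exact (hv ▸ h.mark w).trans (Nat.le_succ _)
    · refine IsBest.of_forall (hv ▸ h.best) (Nat.le_succ _) (fun _ _ => Iff.rfl)
        fun N hN u hu huv => .inl ?_
      rcases (lt_succ_iff_lt_or_eq u).1 huv with huv | rfl
      · exact ⟨u, hu, huv⟩
      · obtain ⟨u', hlt', hr⟩ := (h.mem_iff u).1 hvL
        refine ⟨u', ?_, hv ▸ hlt'⟩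
        rw [hN.eq_ancestors hu]
        exact hr

/-! ### Output and total running time -/

theorem outputLinks_ok {s : Store} (hs : HasInput A B c s) (x : Fin n) (hx : s.nreg 9 = x) :
    Ok outputLinks s fun t s' =>
      (∀ j : Fin q, s'.narr 3 j 0 = 1 ↔ s.narr 3 j 0 = 1 ∨ B x j = true) ∧
      t ≤ 4 * (inputsOf B x).length + 3 := by
  unfold outputLinks
  simp only [ok_seq, ok_instr, Instr.exec]
  set l := inputsOf B x with hl
  have h16 : ∀ s', Frame (Prog.load 17 2 9 15 ;; Prog.store 3 17 2 18 ;; Prog.succ 15)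
      ((s.setN 16 (s.narr 1 (s.nreg 9) (s.nreg 2))).setN 15 0) s' → s'.nreg 16 = l.length := by
    intro s' hF
    rw [hF.nreg 16 (by rfl)]
    simp [Store.setN_nreg, hx, hs.zero, hs.length, hl]
  refine ok_while
    (fun s' => s'.nreg 15 ≤ l.length ∧
      ∀ j : Fin q, s'.narr 3 j 0 = 1 ↔ s.narr 3 j 0 = 1 ∨ j ∈ l.take (s'.nreg 15))
    (fun s' => 4 * (l.length - s'.nreg 15)) ?_ ?_ ?_
  · simp [Store.setN_nreg, Store.setN_narr]
  · rintro s' hF ⟨hle, h1⟩ hlt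
    have hs' : HasInput A B c s' := (hs.congr (by rfl) (by rfl) (by rfl) (by rfl) (by rfl) (by rfl)
      (by rfl) (by rfl)).frame hF (by rfl)
    have h9 : s'.nreg 9 = x := (hF.nreg 9 (by rfl)).trans hx
    rw [h16 s' hF] at hlt
    have hj : s'.narr 2 (s'.nreg 9) (s'.nreg 15) = (l[s'.nreg 15] : Fin q) := by
      rw [h9]; exact hs'.links x _ hlt
    simp only [ok_seq, ok_instr, Instr.exec, Store.setN_nreg, Store.setN_narr,
      Store.setNArr_nreg, reduceIte, Nat.reduceEqDiff, hj, hs'.zero, hs'.one]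
    refine ⟨⟨by omega, fun j => ?_⟩, by omega⟩
    rw [← List.take_concat_get' l _ hlt, List.mem_append, List.mem_singleton, ← or_assoc, ← h1,
      Store.setNArr_narr]
    by_cases hjy : j = l[s'.nreg 15]
    · simp [hjy]
    · simp [hjy, Fin.val_inj, Store.setN_narr]
  · rintro t s' hF ⟨hle, h1⟩ hlt ht
    rw [h16 s' hF] at hlt
    refine ⟨fun j => ?_, ?_⟩
    · rw [h1, List.take_of_length_le (by omega), mem_inputsOf]
    · simp only [Store.setN_nreg, reduceIte] at ht
      omega

theorem outputBest_ok {s : Store} (hs : HasInput A B c s) :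
    Ok outputBest s fun t s' =>
      (∀ j : Fin q, s'.narr 3 j 0 = 1 ↔
        s.narr 3 j 0 = 1 ∨ ∃ x : Fin n, s.narr 6 x 0 = s.nreg 14 ∧ B x j = true) ∧
      t ≤ ∑ i, (4 * (inputsOf B i).length + 8) + 2 := by
  unfold outputBest
  simp only [ok_seq, ok_instr, Instr.exec]
  refine ok_while
    (fun s' => s'.nreg 9 ≤ n ∧ ∀ j : Fin q, s'.narr 3 j 0 = 1 ↔ s.narr 3 j 0 = 1 ∨
      ∃ x : Fin n, (x : ℕ) < s'.nreg 9 ∧ s.narr 6 x 0 = s.nreg 14 ∧ B x j = true)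
    -- Each vertex still to be inspected reserves its own output cost, so the total is linear in
    -- vertices plus links.
    (fun s' => ∑ i : Fin n with s'.nreg 9 ≤ i.val, (4 * (inputsOf B i).length + 8)) ?_ ?_ ?_
  · simp [Store.setN_nreg, Store.setN_narr]
  · rintro s' hF ⟨hle, h1⟩ hlt
    have hs' : HasInput A B c s' := (hs.congr (by rfl) (by rfl) (by rfl) (by rfl) (by rfl) (by rfl)
      (by rfl) (by rfl)).frame hF (by rfl)
    rw [hs'.size] at hlt
    obtain ⟨x, hx⟩ : ∃ x : Fin n, s'.nreg 9 = x := ⟨⟨_, hlt⟩, rfl⟩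
    have h14 : s'.nreg 14 = s.nreg 14 := hF.nreg 14 (by rfl)
    have h6 : s'.narr 6 = s.narr 6 := hF.narr 6 (by rfl)
    have hsum : ∑ i : Fin n with (x : ℕ) ≤ i.val, (4 * (inputsOf B i).length + 8) =
        4 * (inputsOf B x).length + 8 +
          ∑ i : Fin n with (x : ℕ) + 1 ≤ i.val, (4 * (inputsOf B i).length + 8) := by
      rw [← Finset.sum_insert (s := {i : Fin n | (x : ℕ) + 1 ≤ i})
        (f := fun i => 4 * (inputsOf B i).length + 8) (by simp)]
      congr 1
      ext i
      simp only [Finset.mem_filter, Finset.mem_insert, Finset.mem_univ, true_and, Fin.ext_iff]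
      omega
    rw [hx] at h1
    have hex : ∀ j : Fin q, (∃ y : Fin n, (y : ℕ) < x + 1 ∧ s.narr 6 y 0 = s.nreg 14 ∧ B y j = true) ↔
        (∃ y : Fin n, (y : ℕ) < x ∧ s.narr 6 y 0 = s.nreg 14 ∧ B y j = true) ∨
          (s.narr 6 x 0 = s.nreg 14 ∧ B x j = true) := fun j => by
      simp only [lt_succ_iff_lt_or_eq, or_and_right, exists_or, exists_eq_left]
    simp only [ok_seq, ok_instr, ok_ifLe, ok_skip, Instr.exec, Store.setN_nreg, Store.setN_narr,
      reduceIte, Nat.reduceEqDiff, hx, hs'.zero, h14, h6, hsum]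
    refine ⟨fun hle₁ => ⟨fun hle₂ => ?_, fun hne => ?_⟩, fun hne => ?_⟩
    · refine Ok.mono (outputLinks_ok (hs'.congr ?_ ?_ ?_ ?_ ?_ ?_ ?_ ?_) x ?_) ?_
      iterate 8 rfl
      · exact hx
      rintro t s₁ hF₁ ⟨ho, ht⟩
      have h9 : s₁.nreg 9 = x := (hF₁.nreg 9 (by rfl)).trans hx
      rw [h9]
      refine ⟨⟨x.2, fun j => ?_⟩, by omega⟩
      rw [ho, hex, ← or_assoc, ← h1]
      simp only [le_antisymm hle₁ hle₂, true_and]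
      rfl
    · refine ⟨⟨x.2, fun j => ?_⟩, by omega⟩
      rw [hex, ← or_assoc, ← h1]
      have : s.narr 6 x 0 ≠ s.nreg 14 := fun h => hne h.ge
      simp [this]
    · refine ⟨⟨x.2, fun j => ?_⟩, by omega⟩
      rw [hex, ← or_assoc, ← h1]
      have : s.narr 6 x 0 ≠ s.nreg 14 := fun h => hne h.le
      simp [this]
  · rintro t s' hF ⟨hle, h1⟩ hlt ht
    have h0 : s'.nreg 0 = n := (hF.nreg 0 (by rfl)).trans hs.size
    have hlt' : ∀ x : Fin n, (x : ℕ) < s'.nreg 9 := fun x => by omega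
    simp only [hlt', true_and] at h1
    refine ⟨h1, ?_⟩
    simp only [Store.setN_nreg, reduceIte, Nat.zero_le, Finset.filter_true] at ht
    omega

theorem sum_length_inputsOf (B : Matrix (Fin n) (Fin q) Bool) :
    ∑ i, (inputsOf B i).length = inputLinkCount B := by
  unfold inputLinkCount
  rw [← Finset.univ_product_univ, Finset.card_filter, Finset.sum_product]
  refine Finset.sum_congr rfl fun i _ => ?_
  rw [← Finset.card_filter, inputsOf,
    ← List.toFinset_card_of_nodup ((List.nodup_finRange q).filter _)]
  congr 1
  ext j
  simp

theorem inputLinkCount_le (B : Matrix (Fin n) (Fin q) Bool) : inputLinkCount B ≤ n * q := by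
  unfold inputLinkCount
  exact (Finset.card_le_univ _).trans (by simp)

theorem hasInput_inputStore (A : Matrix (Fin n) (Fin n) Bool) (B : Matrix (Fin n) (Fin q) Bool)
    (c : Fin q → ℝ) : HasInput A B c ((inputStore A B c).setN 18 1) := by
  constructor <;> simp +contextual [inputStore, Store.setN]

theorem candidateInv_init (A : Matrix (Fin n) (Fin n) Bool) (B : Matrix (Fin n) (Fin q) Bool)
    (c : Fin q → ℝ) : CandidateInv A B c [] [] ((inputStore A B c).setN 18 1) := by
  refine ⟨hasInput_inputStore A B c, ?_, ⟨?_, ?_, ?_, ?_⟩, ?_, ⟨?_, ?_, ?_, ?_⟩, ?_, ?_, ?_, ?_, ?_, ?_, ?_⟩ <;>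
    simp [inputStore, Store.setN]

/-- Once all vertices are in range, `b = 0` would mean that there is no source SCC, which is
impossible in a nonempty finite digraph. -/
theorem IsBest.isLeast {μ : Fin n → ℕ} {b : ℕ} {r : ℝ} (hn : 0 < n) (h : IsBest A B c n μ b r) :
    IsSourceSCC (stateDigraph A) {w | μ w = b} ∧ r = adjacentInputCost A B c {w | μ w = b} ∧
      IsLeast (sourceCosts A B c) r := by
  have hb : b ≠ 0 := by
    intro hb
    obtain ⟨N, -, hN⟩ := exists_isSourceSCC_subset (G := stateDigraph A) (U := Set.univ)
      ⟨⟨0, hn⟩, trivial⟩ fun _ _ _ _ => trivial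
    obtain ⟨u, hu⟩ := (isSourceSCC_iff.1 hN).1.1
    exact h.1 hb N hN u hu u.2
  obtain ⟨-, h2, h3, h4⟩ := h.2 hb
  refine ⟨h2, h3, ⟨_, h2, h3⟩, ?_⟩
  rintro _ ⟨N, hN, rfl⟩
  obtain ⟨u, hu⟩ := (isSourceSCC_iff.1 hN).1.1
  exact h4 N hN u hu u.2

theorem deletionProgram_ok (A : Matrix (Fin n) (Fin n) Bool) (B : Matrix (Fin n) (Fin q) Bool)
    (c : Fin q → ℝ) (hn : 0 < n) :
    Ok deletionProgram (inputStore A B c) fun t s =>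
      t ≤ 72 * n ^ 2 + 12 * inputLinkCount B ∧
      IsLeast (sourceCosts A B c) (outputValue s) ∧
      ∃ N, IsSourceSCC (stateDigraph A) N ∧ outputValue s = adjacentInputCost A B c N ∧
        ∀ j, j ∈ outputSet q s ↔ ∃ i ∈ N, B i j = true := by
  unfold deletionProgram
  simp only [ok_seq, ok_instr, Instr.exec]
  refine ok_while_potential (m := candidatePotential B [] [] 0)
    (fun m s => ∃ L R, CandidateInv A B c L R s ∧ m = candidatePotential B L R (s.nreg 3)) ?_ ?_ ?_
  · exact ⟨[], [], candidateInv_init A B c, by simp [Store.setN, inputStore]⟩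
  · rintro m s hF ⟨L, R, h, rfl⟩ hlt
    refine (candidateStep_ok h (h.input.size ▸ hlt)).mono ?_
    rintro t s' - ⟨L', R', h', ht⟩
    exact ⟨_, ⟨L', R', h', rfl⟩, ht⟩
  · rintro t m s hF ⟨L, R, h, rfl⟩ hlt ht
    have h3 : s.nreg 3 = n := by
      have := h.le; have := h.input.size; omega
    have hbest := h.best
    rw [h3] at hbest
    obtain ⟨h1, h2, h4⟩ := hbest.isLeast hn
    refine (outputBest_ok h.input).mono ?_
    rintro t' s' hF' ⟨ho, ht'⟩
    have hval : outputValue s' = s.rreg 0 := hF'.rreg 0 (by rfl)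
    have hout : ∀ j : Fin q, s.narr 3 j 0 = 0 := fun j => by
      rw [hF.narr 3 (by rfl)]; simp [Store.setN, inputStore]
    rw [hval]
    refine ⟨?_, h4, _, h1, h2, fun j => ?_⟩
    · have hE := sum_length_inputsOf B
      simp only [candidatePotential, backwardPotential, Finset.sum_add_distrib, ← Finset.mul_sum, hE,
        List.not_mem_nil, not_false_eq_true, Finset.filter_true, Finset.sum_const, Finset.card_univ,
        Fintype.card_fin, smul_eq_mul, List.length_nil, Nat.sub_zero] at ht ht'
      have ht₁ := (Nat.le_add_right _ _).trans ht
      have hsq : n ≤ n * n := Nat.le_mul_self n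
      -- The potentials and the output add up to at most `20 * n ^ 2 + 46 * n + 12 * inputLinkCount
      -- B + 4`; then use `1 ≤ n ≤ n * n`.
      nlinarith
    · simp [outputSet, ho, hout]

end Main

end ActuatorDeletion

open ActuatorDeletion in
/-- Minimal cost actuator deletion when every state vertex has a self-loop: the optimal value is the
minimum over the source SCCs of the cost of the adjacent inputs, and one fixed program computes the
optimal value and an optimal set of actuators within a constant times
(number of states) ^ 2 + (number of input links) steps; this is a constant times
(number of states) ^ 2 as soon as there are at most as many inputs as states. -/
theorem mainTheorem8 :
    (∀ (n q : ℕ) (A : Matrix (Fin n) (Fin n) Bool) (B : Matrix (Fin n) (Fin q) Bool)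
        (c : Fin q → ℝ), 0 < n → (∀ j, 0 ≤ c j) → (∀ i, A i i = true) →
      ∃ v : ℝ, IsLeast (feasibleCosts A B c) v ∧ IsLeast (sourceCosts A B c) v) ∧
    (∃ (P : Prog) (K : ℕ), ∀ (n q : ℕ) (A : Matrix (Fin n) (Fin n) Bool)
        (B : Matrix (Fin n) (Fin q) Bool) (c : Fin q → ℝ),
        0 < n → (∀ j, 0 ≤ c j) → (∀ i, A i i = true) →
      ∃ (t : ℕ) (s : Store), Runs P (inputStore A B c) t s ∧
        t ≤ K * (n ^ 2 + inputLinkCount B) ∧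
        (q ≤ n → t ≤ K * n ^ 2) ∧
        IsLeast (feasibleCosts A B c) (outputValue s) ∧
        IsInputRemovalSet A B (outputSet q s) ∧
        ∑ j ∈ outputSet q s, c j = outputValue s) := by
  classical
  -- `84 = 72 + 12`: for `q ≤ n` there are at most `n ^ 2` links, so both time bounds hold with this
  -- constant.
  refine ⟨fun n q A B c hn hc hA => ?_, deletionProgram, 84, fun n q A B c hn hc hA => ?_⟩
  · have : Nonempty (Fin n) := ⟨⟨0, hn⟩⟩
    obtain ⟨v, hv⟩ := exists_isLeast_sourceCosts A B c
    exact ⟨v, isLeast_feasibleCosts_of_isLeast_sourceCosts hA hc hv, hv⟩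
  · obtain ⟨t, s, hrun, ht, hleast, N, hN, hval, hout⟩ := deletionProgram_ok A B c hn
    refine ⟨t, s, hrun, by omega, fun hq => ?_,
      isLeast_feasibleCosts_of_isLeast_sourceCosts hA hc hleast,
      (isInputRemovalSet_iff hA).2 ⟨N, hN, fun i hi j hij => (hout j).2 ⟨i, hi, hij⟩⟩, ?_⟩
    · have h1 := inputLinkCount_le B
      have h2 := Nat.mul_le_mul_left n hq
      rw [← sq] at h2
      omega
    · rw [hval, adjacentInputCost_eq]
      exact Finset.sum_congr (Finset.ext fun j => by rw [hout]; simp) fun _ _ => rfl
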